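/- **Setting.** Let $h_1,h_2,h_3\in\mathbb R$. Let $S_1,S_2,\dots$ be i.i.d. uniform on $\{1,-1\}$ and let $N_{r,i},N_{d,i},N'_{d,i}$ be standard Gaussian, all independent. The relay observes $U_i=h_1S_i+N_{r,i}$ and the destination observes $X_i=h_3S_i+N_{d,i}$, $1\le i\le n$. The relay forwards $V^n$, drawn from an arbitrary conditional law $K_n(\cdot\mid U^n)$ (an *attack* is an arbitrary sequence $(K_n)_n$ of Markov kernels from $\mathbb R^n$ to $\mathbb R^n$; given $U^n$, $V^n$ is independent of all else), and the destination receives $Y_i=h_2V_i+N'_{d,i}$. Let $f_{U|X}(u|x)=\sum_{s=\pm1}P_{S|X}(s|x)\frac{1}{\sqrt{2\pi}}e^{-(u-h_1s)^2/2}$ with $P_{S|X}(s|x)=e^{-(x-h_3s)^2/2}/\sum_{s'=\pm1}e^{-(x-h_3s')^2/2}$, and $F_{Y|V}(y|v)=\int_{-\infty}^y\frac{1}{\sqrt{2\pi}}e^{-(t-h_2v)^2/2}\,dt$. The observation channel $(f_{U|X},F_{Y|V})$ is *manipulable* if there is a conditional law (Markov kernel) $\Psi(dv|u)$ on $\mathbb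 R$, not equal to $\delta_u(dv)$ for Lebesgue-almost every $u$, such that for all $x,y$ $$\int\!\!\int f_{U|X}(u|x)F_{Y|V}(y|v)\,\Psi(dv|u)\,du=\int f_{U|X}(u|x)F_{Y|V}(y|u)\,du ,$$ and *non-manipulable* otherwise. **Quantization.** The quantizer $(\alpha,\beta,N)$ has the $N$ cells $(-\infty,\alpha]$, the $N-2$ half-open intervals (closed on the right) of equal length $\frac{\beta-\alpha}{N-2}$ that partition $(\alpha,\beta]$, and $(\beta,\infty)$. At level $n'$, $U$ is quantized by $(\alpha_1,\beta_1,n')$ into cells $B^U_i$ and $V$ by $(\alpha_2,\beta_2,n_v)$ into cells $B^V_j$, with parameters depending on $n'$ such that, as $n'\to\infty$, $n_v\to\infty$, both cell lengths tend to $0$, $\alpha_2\to-\infty$, $\beta_2\to\infty$, and, for all large $n'$, $\alpha_1<\beta_1$, $\alpha_2<\beta_2$ and each $B^U_i$ is, for each $j$, either contained in or disjoint from $B^V_j$. Let $W_0(i,j)=1$ if $B^U_i\subseteq B^V_j$ and $0$ otherwise; let $\Delta F(j|i)=\#\{l\le n:U_l\in B_i^U,V_l\in B^V_j\}/\#\{l\le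 n:U_l\in B_i^U\}$ ($0$ if the denominator is $0$), and $$R_{n,n'}=\sum_{j=1}^{n_v}\sum_{i=1}^{n'}|\Delta F(j|i)-W_0(i,j)| .$$ **Theorem.** For all $h_1,h_2,h_3$ and every such family of quantizers, the observation channel is non-manipulable if and only if there are decision statistics $D^n=D^n(X^n,Y^n)$, measurable real functions not depending on the attack, $n'$ or $\delta$, and a function $\mu'(n',\delta)$ with $\mu'(n',\delta)\to0$ as $n'\to\infty,\ \delta\to0^+$, such that for every $\eta>0$ there is a function $\varepsilon(n',\delta)$ with values in $(0,\eta)$ for which the following holds: for all sufficiently small $\delta>0$ and $\epsilon>0$, for all sufficiently large $n'$ and for every attack, 1. if $\liminf_{n\to\infty}\Pr(R_{n,n'}>\delta)>0$, then $\lim_{n\to\infty}\Pr(D^n>\varepsilon(n',\delta)\mid R_{n,n'}>\delta)$ exists and is $\ge1-\epsilon$; 2. if $\liminf_{n\to\infty}\Pr(R_{n,n'}<\delta)>0$, then $\lim_{n\to\infty}\Pr(D^n>\mu'(n',\delta)\mid R_{n,n'}\le\delta)$ exists and is $\le\epsilon$. -/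

import Mathlib

open MeasureTheory ProbabilityTheory Filter Topology

noncomputable section

namespace RelayNetwork

/-! ### The observation channel -/

/-- Density of the relay's observation `U = h₁ S + N_r` given `S = s`. -/
def fUS (h₁ u s : ℝ) : ℝ := gaussianPDFReal (h₁ * s) 1 u

/-- Posterior probability of the symbol `s ∈ {1, -1}` given `X = x`, for `X = h₃ S + N_d` and
`S` equiprobable on `{1, -1}`. -/
def pSX (h₃ s x : ℝ) : ℝ :=
  Real.exp (-(x - h₃ * s) ^ 2 / 2) /
    (Real.exp (-(x - h₃ * 1) ^ 2 / 2) + Real.exp (-(x - h₃ * (-1)) ^ 2 / 2))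

/-- Conditional density `f_{U|X}(u|x)`. -/
def fUX (h₁ h₃ u x : ℝ) : ℝ :=
  pSX h₃ 1 x * fUS h₁ u 1 + pSX h₃ (-1) x * fUS h₁ u (-1)

/-- Conditional distribution function `F_{Y|V}(y|v)` for `Y = h₂ V + N_d'`. -/
def FYV (h₂ y v : ℝ) : ℝ := ∫ t in Set.Iic y, gaussianPDFReal (h₂ * v) 1 t

/-- The observation channel is manipulable if some conditional law `Ψ(dv|u)` that is not the
identity law `δ_u(dv)` (up to a Lebesgue-null set of `u`) gives the same law of `Y` given `X`
as faithful forwarding. Conditional laws are Markov kernels, since the identity itself is an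
impulse and the relay's output may be discrete or continuous. -/
def Manipulable (h₁ h₂ h₃ : ℝ) : Prop :=
  ∃ Ψ : Kernel ℝ ℝ, IsMarkovKernel Ψ ∧
    (¬ ∀ᵐ u ∂(volume : Measure ℝ), Ψ u = Measure.dirac u) ∧
    ∀ x y : ℝ, ∫ u, fUX h₁ h₃ u x * (∫ v, FYV h₂ y v ∂(Ψ u)) = ∫ u, fUX h₁ h₃ u x * FYV h₂ y u

/-- The observation channel is non-manipulable. -/
def NonManipulable (h₁ h₂ h₃ : ℝ) : Prop := ¬ Manipulable h₁ h₂ h₃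

/-! ### Quantization -/

/-- Width of the bounded cells of the quantizer with parameters `(α, β, N)`. -/
def step (α β : ℝ) (N : ℕ) : ℝ := (β - α) / ((N : ℝ) - 2)

/-- The `N` cells of the quantizer `(α, β, N)`, numbered from `0`: the half-line `(-∞, α]`, then
`N - 2` half-open intervals of equal width from `α` to `β`, then `(β, ∞)`. -/
def cell (α β : ℝ) (N : ℕ) (j : Fin N) : Set ℝ :=
  if j.val = 0 then Set.Iic α
  else if j.val + 1 = N then Set.Ioi β
  else Set.Ioc (α + ((j.val : ℝ) - 1) * step α β N) (α + (j.val : ℝ) * step α β N)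

/-- A family of quantizers indexed by the level `n'`: at level `n'` the relay's input is quantized
according to `(α₁ n', β₁ n', n')` and its output according to `(α₂ n', β₂ n', nv n')`. For large
levels each input cell is contained in one output cell; the mesh tends to `0` and the quantized
range exhausts the line (by nestedness also for the input). -/
structure QuantScheme where
  α₁ : ℕ → ℝ
  β₁ : ℕ → ℝ
  α₂ : ℕ → ℝ
  β₂ : ℕ → ℝ
  nv : ℕ → ℕ
  lt₁ : ∀ᶠ n' in atTop, α₁ n' < β₁ n'
  lt₂ : ∀ᶠ n' in atTop, α₂ n' < β₂ n'
  tendsto_nv : Tendsto nv atTop atTop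
  tendsto_step₁ : Tendsto (fun n' => step (α₁ n') (β₁ n') n') atTop (𝓝 0)
  tendsto_step₂ : Tendsto (fun n' => step (α₂ n') (β₂ n') (nv n')) atTop (𝓝 0)
  tendsto_α₂ : Tendsto α₂ atTop atBot
  tendsto_β₂ : Tendsto β₂ atTop atTop
  nested : ∀ᶠ n' in atTop, ∀ (i : Fin n') (j : Fin (nv n')),
    cell (α₁ n') (β₁ n') n' i ⊆ cell (α₂ n') (β₂ n') (nv n') j ∨
      Disjoint (cell (α₁ n') (β₁ n') n' i) (cell (α₂ n') (β₂ n') (nv n') j)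

namespace QuantScheme

/-- Input cells at level `n'`. -/
def cellU (Q : QuantScheme) (n' : ℕ) (i : Fin n') : Set ℝ := cell (Q.α₁ n') (Q.β₁ n') n' i

/-- Output cells at level `n'`. -/
def cellV (Q : QuantScheme) (n' : ℕ) (j : Fin (Q.nv n')) : Set ℝ :=
  cell (Q.α₂ n') (Q.β₂ n') (Q.nv n') j

end QuantScheme

/-- Sequences of `n` real symbols. -/
abbrev Seq (n : ℕ) : Type := Fin n → ℝ

/-- Number of symbols of the sequence `u` in the set `B`. -/
def count {n : ℕ} (B : Set ℝ) (u : Seq n) : ℝ := ∑ l, B.indicator (fun _ => (1 : ℝ)) (u l)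

open Classical in
/-- Empirical transition probability from input cell `i` to output cell `j`, and `0` if the input
cell is not visited. -/
def empKernel (Q : QuantScheme) (n' : ℕ) {n : ℕ} (u v : Seq n)
    (i : Fin n') (j : Fin (Q.nv n')) : ℝ :=
  if count (Q.cellU n' i) u = 0 then 0
  else (∑ l, (Q.cellV n' j).indicator (fun _ => (1 : ℝ)) (v l) *
      (Q.cellU n' i).indicator (fun _ => (1 : ℝ)) (u l)) / count (Q.cellU n' i) u

open Classical in
/-- The quantized identity kernel `W₀`. -/
def idKernel (Q : QuantScheme) (n' : ℕ) (i : Fin n') (j : Fin (Q.nv n')) : ℝ :=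
  if Q.cellU n' i ⊆ Q.cellV n' j then 1 else 0

/-- The sum of absolute differences between the empirical kernel and the identity kernel. -/
def deviation (Q : QuantScheme) (n' : ℕ) {n : ℕ} (u v : Seq n) : ℝ :=
  ∑ j : Fin (Q.nv n'), ∑ i : Fin n', |empKernel Q n' u v i j - idKernel Q n' i j|

/-! ### The network -/

/-- The equiprobable law on `{1, -1}`. -/
def symbolLaw : Measure ℝ :=
  (2⁻¹ : ENNReal) • (Measure.dirac (1 : ℝ) + Measure.dirac (-1 : ℝ))

/-- Symbols and noises: `(S, N_r, N_d, N_d')`, each a sequence of length `n`. -/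
abbrev Primitive (n : ℕ) : Type := Seq n × Seq n × Seq n × Seq n

/-- All symbols and noises are independent; symbols are equiprobable, noises standard normal. -/
def primitiveLaw (n : ℕ) : Measure (Primitive n) :=
  (Measure.pi fun _ => symbolLaw).prod
    ((Measure.pi fun _ => gaussianReal 0 1).prod
      ((Measure.pi fun _ => gaussianReal 0 1).prod (Measure.pi fun _ => gaussianReal 0 1)))

/-- The relay's observation `U = h₁ S + N_r`. -/
def relayInput (h₁ : ℝ) {n : ℕ} (w : Primitive n) : Seq n := fun l => h₁ * w.1 l + w.2.1 l

lemma measurable_relayInput (h₁ : ℝ) (n : ℕ) :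
    Measurable (relayInput h₁ : Primitive n → Seq n) := by
  unfold relayInput
  fun_prop

/-- Law of the primitives together with the relay's output `V`, when the relay uses the attack `K`,
an arbitrary conditional law of the output sequence given the input sequence. The output depends on
the primitives only through the relay's input. -/
def networkLaw (h₁ : ℝ) {n : ℕ} (K : Kernel (Seq n) (Seq n)) : Measure (Primitive n × Seq n) :=
  primitiveLaw n ⊗ₘ K.comap (relayInput h₁) (measurable_relayInput h₁ n)

/-- `U` as a random sequence on the sample space of the network. -/
def seqU (h₁ : ℝ) {n : ℕ} (ω : Primitive n × Seq n) : Seq n := relayInput h₁ ω.1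

/-- `V`, the sequence forwarded by the relay. -/
def seqV {n : ℕ} (ω : Primitive n × Seq n) : Seq n := ω.2

/-- `X = h₃ S + N_d`, received by the destination from the source. -/
def seqX (h₃ : ℝ) {n : ℕ} (ω : Primitive n × Seq n) : Seq n :=
  fun l => h₃ * ω.1.1 l + ω.1.2.2.1 l

/-- `Y = h₂ V + N_d'`, received by the destination from the relay. -/
def seqY (h₂ : ℝ) {n : ℕ} (ω : Primitive n × Seq n) : Seq n :=
  fun l => h₂ * seqV ω l + ω.1.2.2.2 l

/-- The random deviation of the relay's empirical kernel from the identity kernel. -/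
def R (Q : QuantScheme) (h₁ : ℝ) (n' : ℕ) {n : ℕ} (ω : Primitive n × Seq n) : ℝ :=
  deviation Q n' (seqU h₁ ω) (seqV ω)

end RelayNetwork

end

/-! Both sides of the equivalence hold exactly when $h_1,h_2,h_3$ are all nonzero.

Suppose that they are, and put $c=h_1/h_2$. Given $U=u$ and $V=v$, the test function $1_{Y\le
c}-1_{Y\le -c}-\frac{X}{h_3}(1_{Y\le c}+1_{Y\le -c})$ has mean `regr h₁ h₂ u v`, because
$E[X/h_3\mid U=u]=E[S\mid U=u]=\tanh(h_1u)$. The thresholds $\pm c$ are chosen so that the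
$v$-derivative of the signed excess `gap` is a positive multiple of $h_1\sinh(h_1(v-u))$
(`hasDerivAt_gap`). Hence `gap` vanishes at $v=u$ and is positive elsewhere (`gap_pos`): a single
scalar mean separates faithful forwarding from everything else.

Non-manipulability (`nonManipulable_of_ne_zero`): as $h_3\ne0$, a kernel that preserves the law of
$Y$ given $X$ also preserves the law of $Y$ given $S$. The mean of `gap` under the kernel is a
combination of these preserved quantities, so it is zero, and the kernel is the identity almost
everywhere.

Detection (`detectable_of_ne_zero`): whatever the attack, the empirical mean of the test function
differs from its faithful value by the empirical mean of `gap`, up to scaling and averages of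
conditionally centred independent terms (`tendsto_statistic_sub_meanGap`). A small deviation $R$
keeps most outputs in the output cell of their input, so the mean gap is small (`meanGap_le`). A
large $R$ forces many exits from some input cell; few inputs lie near the boundary of that cell, so
most exits cost a gap bounded below (`exists_threshold`).

If some $h_i=0$, the reversal $V=-U$ gives the destination the same law as $V=U$, by a symmetry of
the symbols and noises. The channel is then manipulable (`manipulable_of_eq_zero`). Statistics with
false-alarm level tending to $0$ rarely exceed any positive level under faithful forwarding, hence
also under reversal, although the deviation there is at least $1$ with probability tending to $1$
(`not_detects_of_eq_zero`). -/

noncomputable section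

namespace RelayNetwork

/-! ### The regression gap -/

/-- The standard normal distribution function. -/
def stdCDF (z : ℝ) : ℝ := (gaussianReal 0 1).real (Set.Iic z)

lemma stdCDF_nonneg (z : ℝ) : 0 ≤ stdCDF z := measureReal_nonneg

lemma stdCDF_le_one (z : ℝ) : stdCDF z ≤ 1 := measureReal_le_one

lemma hasDerivAt_stdCDF (z : ℝ) : HasDerivAt stdCDF (gaussianPDFReal 0 1 z) z := by
  have hint := integrable_gaussianPDFReal 0 1
  have hcont : Continuous (gaussianPDFReal 0 1) := by
    unfold gaussianPDFReal
    fun_prop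
  have key : stdCDF = fun z => (∫ t in (0 : ℝ)..z, gaussianPDFReal 0 1 t) + stdCDF 0 := by
    funext z
    have h : ∀ z, stdCDF z = ∫ t in Set.Iic z, gaussianPDFReal 0 1 t := fun z => by
      rw [stdCDF, measureReal_def, gaussianReal_apply_eq_integral 0 one_ne_zero,
        ENNReal.toReal_ofReal (integral_nonneg fun t => gaussianPDFReal_nonneg 0 1 t)]
    rw [h, h, ← intervalIntegral.integral_Iic_sub_Iic hint.integrableOn hint.integrableOn]
    ring
  rw [key]
  exact (intervalIntegral.integral_hasDerivAt_right (hcont.intervalIntegrable 0 z)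
    (hcont.stronglyMeasurableAtFilter _ _) hcont.continuousAt).add_const _

lemma FYV_eq_stdCDF (h₂ y v : ℝ) : FYV h₂ y v = stdCDF (y - h₂ * v) := by
  rw [FYV, stdCDF, measureReal_def]
  have h := gaussianReal_map_const_add (μ := 0) (v := 1) (h₂ * v)
  have h1 : gaussianReal (h₂ * v) 1 (Set.Iic y) = gaussianReal 0 1 (Set.Iic (y - h₂ * v)) := by
    have h' : h₂ * v = 0 + h₂ * v := by ring
    rw [h', ← h, Measure.map_apply (by fun_prop) measurableSet_Iic]
    congr 1
    ext x
    simp only [Set.mem_preimage, Set.mem_Iic]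
    constructor <;> intro hx <;> linarith
  rw [← h1, gaussianReal_apply_eq_integral _ one_ne_zero,
    ENNReal.toReal_ofReal (integral_nonneg fun t => gaussianPDFReal_nonneg _ 1 t)]

lemma FYV_nonneg (h₂ y v : ℝ) : 0 ≤ FYV h₂ y v := by
  rw [FYV_eq_stdCDF]; exact stdCDF_nonneg _

lemma FYV_le_one (h₂ y v : ℝ) : FYV h₂ y v ≤ 1 := by
  rw [FYV_eq_stdCDF]; exact stdCDF_le_one _

lemma hasDerivAt_FYV (h₂ y v : ℝ) :
    HasDerivAt (FYV h₂ y) (-h₂ * gaussianPDFReal 0 1 (y - h₂ * v)) v := by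
  have h : FYV h₂ y = fun v => stdCDF (y - h₂ * v) := funext fun v => FYV_eq_stdCDF h₂ y v
  rw [h]
  have h2 : HasDerivAt (fun v => y - h₂ * v) (-h₂) v := by
    simpa using ((hasDerivAt_id v).const_mul h₂).const_sub y
  have := (hasDerivAt_stdCDF (y - h₂ * v)).comp v h2
  rwa [mul_comm] at this

@[fun_prop]
lemma continuous_FYV (h₂ y : ℝ) : Continuous (FYV h₂ y) :=
  continuous_iff_continuousAt.2 fun v => (hasDerivAt_FYV h₂ y v).continuousAt

lemma integral_indicator_Iic_add (h₂ y v : ℝ) :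
    ∫ z, (Set.Iic y).indicator (fun _ => (1 : ℝ)) (h₂ * v + z) ∂(gaussianReal 0 1) =
      FYV h₂ y v := by
  have h : (fun z => (Set.Iic y).indicator (fun _ => (1 : ℝ)) (h₂ * v + z)) =
      (Set.Iic (y - h₂ * v)).indicator 1 := by
    funext z
    simp only [Set.indicator, Set.mem_Iic, Pi.one_apply]
    congr 1
    exact propext ⟨fun h => by linarith, fun h => by linarith⟩
  rw [h, integral_indicator_one measurableSet_Iic, FYV_eq_stdCDF, stdCDF]

lemma gaussianPDFReal_std_le_one (z : ℝ) : gaussianPDFReal 0 1 z ≤ 1 := by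
  rw [gaussianPDFReal]
  have h1 : (√(2 * Real.pi * (1 : NNReal)))⁻¹ ≤ 1 := by
    apply inv_le_one_of_one_le₀
    rw [Real.one_le_sqrt]
    have := Real.pi_gt_three
    push_cast
    linarith
  have h2 : Real.exp (-(z - 0) ^ 2 / (2 * (1 : NNReal))) ≤ 1 := by
    rw [Real.exp_le_one_iff]
    push_cast
    nlinarith [sq_nonneg (z - 0)]
  exact mul_le_one₀ h1 (Real.exp_nonneg _) h2

lemma abs_FYV_sub_le (h₂ y u v : ℝ) : |FYV h₂ y v - FYV h₂ y u| ≤ |h₂| * |v - u| := by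
  have := Convex.norm_image_sub_le_of_norm_hasDerivWithin_le (f := FYV h₂ y) (s := Set.univ)
    (f' := fun w => -h₂ * gaussianPDFReal 0 1 (y - h₂ * w)) (C := |h₂|) (x := u) (y := v)
    (fun w _ => (hasDerivAt_FYV h₂ y w).hasDerivWithinAt)
    (fun w _ => by
      rw [Real.norm_eq_abs, abs_mul, abs_neg, abs_of_nonneg (gaussianPDFReal_nonneg _ _ _)]
      exact mul_le_of_le_one_right (abs_nonneg _) (gaussianPDFReal_std_le_one _))
    convex_univ (Set.mem_univ u) (Set.mem_univ v)
  simpa using this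

/-- The mean of `E[S | U = u]`-corrected threshold statistics of `Y`, given `U = u` and `V = v`. -/
def regr (h₁ h₂ u v : ℝ) : ℝ :=
  (FYV h₂ (h₁ / h₂) v - FYV h₂ (-(h₁ / h₂)) v) -
    Real.tanh (h₁ * u) * (FYV h₂ (h₁ / h₂) v + FYV h₂ (-(h₁ / h₂)) v)

/-- The excess of `regr` over its value at faithful forwarding, signed so as to be nonnegative. -/
def gap (h₁ h₂ u v : ℝ) : ℝ := -(h₁ * h₂) * (regr h₁ h₂ u v - regr h₁ h₂ u u)

lemma gap_self (h₁ h₂ u : ℝ) : gap h₁ h₂ u u = 0 := by simp [gap]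

lemma continuous_tanh : Continuous Real.tanh := by
  have : Real.tanh = fun x => Real.sinh x / Real.cosh x := funext Real.tanh_eq_sinh_div_cosh
  rw [this]
  exact Real.continuous_sinh.div Real.continuous_cosh fun x => (Real.cosh_pos x).ne'

lemma abs_tanh_le_one (x : ℝ) : |Real.tanh x| ≤ 1 := by
  rw [Real.tanh_eq_sinh_div_cosh, abs_div, abs_of_pos (Real.cosh_pos x),
    div_le_one (Real.cosh_pos x), abs_le]
  constructor
  · have := Real.sinh_lt_cosh (-x); rw [Real.sinh_neg, Real.cosh_neg] at this; linarith
  · exact (Real.sinh_lt_cosh x).le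

lemma continuous_regr (h₁ h₂ : ℝ) : Continuous fun p : ℝ × ℝ => regr h₁ h₂ p.1 p.2 := by
  have h := continuous_tanh
  unfold regr
  fun_prop

lemma continuous_gap (h₁ h₂ : ℝ) : Continuous fun p : ℝ × ℝ => gap h₁ h₂ p.1 p.2 := by
  have h := continuous_regr h₁ h₂
  have h' : Continuous fun p : ℝ × ℝ => regr h₁ h₂ p.1 p.1 :=
    Continuous.comp (g := fun p : ℝ × ℝ => regr h₁ h₂ p.1 p.2) (f := fun p : ℝ × ℝ => (p.1, p.1))
      h (by fun_prop)
  exact continuous_const.mul (h.sub h')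

/-- This is what fixes the threshold: in the exponent the cross term $(h_1/h_2)(h_2v)$ equals
$h_1v$, the tilt that also appears in the likelihood ratio of $U$. -/
lemma gaussianPDFReal_tilt {h₁ h₂ : ℝ} (hh₂ : h₂ ≠ 0) (v : ℝ) :
    gaussianPDFReal 0 1 (h₁ / h₂ - h₂ * v) =
      gaussianPDFReal 0 1 (h₂ * v) * Real.exp (-(h₁ / h₂) ^ 2 / 2) * Real.exp (h₁ * v) := by
  simp only [gaussianPDFReal, mul_assoc, ← Real.exp_add]
  congr 2
  push_cast
  field_simp
  ring

/-- After tilting, the two densities contribute $e^{h_1v}(1-\tanh h_1u)$ and $e^{-h_1v}(1+\tanh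
h_1u)$. Their difference is $2\sinh(h_1(v-u))/\cosh(h_1u)$ by the addition formula. -/
lemma hasDerivAt_gap {h₁ h₂ : ℝ} (hh₂ : h₂ ≠ 0) (u v : ℝ) :
    HasDerivAt (gap h₁ h₂ u)
      (2 * h₂ ^ 2 * (gaussianPDFReal 0 1 (h₂ * v) * Real.exp (-(h₁ / h₂) ^ 2 / 2)) /
        Real.cosh (h₁ * u) * (h₁ * Real.sinh (h₁ * (v - u)))) v := by
  have hp := hasDerivAt_FYV h₂ (h₁ / h₂) v
  have hm := hasDerivAt_FYV h₂ (-(h₁ / h₂)) v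
  have h := (((hp.sub hm).sub ((hp.add hm).const_mul (Real.tanh (h₁ * u)))).sub_const
    (regr h₁ h₂ u u)).const_mul (-(h₁ * h₂))
  have e1 := gaussianPDFReal_tilt (h₁ := h₁) hh₂ v
  -- The threshold $-h_1/h_2$ is the one belonging to $-h_1$.
  have e2 := gaussianPDFReal_tilt (h₁ := -h₁) hh₂ v
  rw [show -h₁ / h₂ = -(h₁ / h₂) by ring, show -h₁ * v = -(h₁ * v) by ring, neg_sq] at e2
  rw [e1, e2] at h
  refine h.congr_deriv ?_
  have hc := (Real.cosh_pos (h₁ * u)).ne'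
  rw [mul_sub h₁, Real.sinh_sub, Real.tanh_eq_sinh_div_cosh, Real.sinh_eq (h₁ * v),
    Real.cosh_eq (h₁ * v)]
  field_simp
  ring

lemma mul_sinh_mul_pos {h x : ℝ} (hh : h ≠ 0) (hx : 0 < x) : 0 < h * Real.sinh (h * x) := by
  rcases lt_or_gt_of_ne hh with h0 | h0
  · exact mul_pos_of_neg_of_neg h0 (Real.sinh_neg_iff.2 (mul_neg_of_neg_of_pos h0 hx))
  · exact mul_pos h0 (Real.sinh_pos_iff.2 (mul_pos h0 hx))

lemma gap_deriv_factor_pos {h₁ h₂ : ℝ} (hh₂ : h₂ ≠ 0) (u v : ℝ) :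
    0 < 2 * h₂ ^ 2 * (gaussianPDFReal 0 1 (h₂ * v) * Real.exp (-(h₁ / h₂) ^ 2 / 2)) /
        Real.cosh (h₁ * u) := by
  have := gaussianPDFReal_pos 0 1 (h₂ * v) one_ne_zero
  have := Real.cosh_pos (h₁ * u)
  positivity

lemma gap_strictMonoOn {h₁ h₂ : ℝ} (hh₁ : h₁ ≠ 0) (hh₂ : h₂ ≠ 0) (u : ℝ) :
    StrictMonoOn (gap h₁ h₂ u) (Set.Ici u) := by
  apply strictMonoOn_of_deriv_pos (convex_Ici u)
  · exact fun v _ => (hasDerivAt_gap hh₂ u v).continuousAt.continuousWithinAt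
  · intro v hv
    rw [interior_Ici, Set.mem_Ioi] at hv
    rw [(hasDerivAt_gap hh₂ u v).deriv]
    exact mul_pos (gap_deriv_factor_pos hh₂ u v) (mul_sinh_mul_pos hh₁ (sub_pos.2 hv))

lemma gap_strictAntiOn {h₁ h₂ : ℝ} (hh₁ : h₁ ≠ 0) (hh₂ : h₂ ≠ 0) (u : ℝ) :
    StrictAntiOn (gap h₁ h₂ u) (Set.Iic u) := by
  apply strictAntiOn_of_deriv_neg (convex_Iic u)
  · exact fun v _ => (hasDerivAt_gap hh₂ u v).continuousAt.continuousWithinAt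
  · intro v hv
    rw [interior_Iic, Set.mem_Iio] at hv
    rw [(hasDerivAt_gap hh₂ u v).deriv]
    have h := mul_sinh_mul_pos hh₁ (sub_pos.2 hv)
    rw [← neg_sub v u, mul_neg, Real.sinh_neg] at h
    exact mul_neg_of_pos_of_neg (gap_deriv_factor_pos hh₂ u v) (by linarith)

/-- The derivative has the sign of $v-u$, so $v=u$ is the only minimizer. -/
lemma gap_pos {h₁ h₂ : ℝ} (hh₁ : h₁ ≠ 0) (hh₂ : h₂ ≠ 0) {u v : ℝ} (h : v ≠ u) :
    0 < gap h₁ h₂ u v := by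
  rw [← gap_self h₁ h₂ u]
  rcases lt_or_gt_of_ne h with h | h
  · exact gap_strictAntiOn hh₁ hh₂ u h.le Set.self_mem_Iic h
  · exact gap_strictMonoOn hh₁ hh₂ u Set.self_mem_Ici h.le h

lemma gap_nonneg {h₁ h₂ : ℝ} (hh₁ : h₁ ≠ 0) (hh₂ : h₂ ≠ 0) (u v : ℝ) : 0 ≤ gap h₁ h₂ u v := by
  by_cases h : v = u
  · rw [h, gap_self]
  · exact (gap_pos hh₁ hh₂ h).le

/-- Least gap among outputs at distance at least `ρ` from the input. -/
lemma min_gap_le {h₁ h₂ : ℝ} (hh₁ : h₁ ≠ 0) (hh₂ : h₂ ≠ 0) {u v ρ : ℝ} (hρ : 0 ≤ ρ)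
    (h : ρ ≤ |u - v|) :
    min (gap h₁ h₂ u (u + ρ)) (gap h₁ h₂ u (u - ρ)) ≤ gap h₁ h₂ u v := by
  rcases le_total u v with huv | huv
  · rw [abs_of_nonpos (by linarith)] at h
    exact (min_le_left _ _).trans ((gap_strictMonoOn hh₁ hh₂ u).monotoneOn
      (by simpa using hρ) huv (by linarith))
  · rw [abs_of_nonneg (by linarith)] at h
    exact (min_le_right _ _).trans ((gap_strictAntiOn hh₁ hh₂ u).antitoneOn huv
      (by simpa using hρ) (by linarith))

/-- With $a,b$ the changes of $F$ at the two thresholds, the change of `regr` is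
$(a-b)-\tanh(h_1u)(a+b)$, and each half is at most $2C$. -/
lemma abs_regr_sub_le (h₁ h₂ u v w : ℝ) {C : ℝ}
    (hC : ∀ y, |FYV h₂ y v - FYV h₂ y w| ≤ C) :
    |regr h₁ h₂ u v - regr h₁ h₂ u w| ≤ 4 * C := by
  have ht := abs_tanh_le_one (h₁ * u)
  have hp := hC (h₁ / h₂)
  have hm := hC (-(h₁ / h₂))
  have hC0 : 0 ≤ C := (abs_nonneg _).trans hp
  set a := FYV h₂ (h₁ / h₂) v - FYV h₂ (h₁ / h₂) w
  set b := FYV h₂ (-(h₁ / h₂)) v - FYV h₂ (-(h₁ / h₂)) w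
  have e : regr h₁ h₂ u v - regr h₁ h₂ u w = (a - b) - Real.tanh (h₁ * u) * (a + b) := by
    simp only [regr, a, b]; ring
  have h1 : |Real.tanh (h₁ * u) * (a + b)| ≤ 2 * C := by
    rw [abs_mul]
    have := abs_add_le a b
    nlinarith [abs_nonneg (a + b), abs_nonneg (Real.tanh (h₁ * u))]
  rw [e]
  have := abs_sub (a - b) (Real.tanh (h₁ * u) * (a + b))
  have := abs_sub a b
  linarith

lemma gap_le_const (h₁ h₂ u v : ℝ) : gap h₁ h₂ u v ≤ 4 * |h₁ * h₂| := by
  have h := abs_regr_sub_le h₁ h₂ u v u (C := 1) fun y => by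
    rw [abs_le]
    constructor <;> linarith [FYV_nonneg h₂ y v, FYV_nonneg h₂ y u, FYV_le_one h₂ y v,
      FYV_le_one h₂ y u]
  refine (le_abs_self _).trans ?_
  rw [gap, abs_mul, abs_neg]
  nlinarith [abs_nonneg (h₁ * h₂)]

lemma gap_le_dist (h₁ h₂ u v : ℝ) : gap h₁ h₂ u v ≤ 4 * |h₁ * h₂| * (|h₂| * |v - u|) := by
  have h := abs_regr_sub_le h₁ h₂ u v u fun y => abs_FYV_sub_le h₂ y u v
  refine (le_abs_self _).trans ?_
  rw [gap, abs_mul, abs_neg]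
  nlinarith [abs_nonneg (h₁ * h₂)]

lemma abs_regr_le (h₁ h₂ u v : ℝ) : |regr h₁ h₂ u v| ≤ 3 := by
  have ht := abs_tanh_le_one (h₁ * u)
  have a0 := FYV_nonneg h₂ (h₁ / h₂) v
  have b0 := FYV_nonneg h₂ (-(h₁ / h₂)) v
  have a1 := FYV_le_one h₂ (h₁ / h₂) v
  have b1 := FYV_le_one h₂ (-(h₁ / h₂)) v
  rw [abs_le] at ht
  rw [regr, abs_le]
  constructor <;> nlinarith

/-! ### Product measures -/

lemma lintegral_pi_prod {ι : Type*} [Fintype ι] {μ : ι → Measure ℝ}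
    [∀ i, IsProbabilityMeasure (μ i)] {f : ι → ℝ → ENNReal} (hf : ∀ i, Measurable (f i)) :
    ∫⁻ x, ∏ i, f i (x i) ∂(Measure.pi μ) = ∏ i, ∫⁻ x, f i x ∂(μ i) := by
  have h := lintegral_prod_eq_prod_lintegral_of_indepFun (μ := Measure.pi μ) Finset.univ
    (fun i (x : ι → ℝ) => f i (x i)) (iIndepFun_pi fun i => (hf i).aemeasurable)
    (fun i => (hf i).comp (measurable_pi_apply i))
  rw [h]
  refine Finset.prod_congr rfl fun i _ => ?_
  rw [← (measurePreserving_eval μ i).map_eq, lintegral_map (hf i) (measurable_pi_apply i)]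

lemma pi_withDensity {ι : Type*} [Fintype ι] {μ : ι → Measure ℝ}
    [∀ i, IsProbabilityMeasure (μ i)] {f : ι → ℝ → ENNReal} (hf : ∀ i, Measurable (f i))
    [∀ i, SigmaFinite ((μ i).withDensity (f i))] :
    Measure.pi (fun i => (μ i).withDensity (f i)) =
      (Measure.pi μ).withDensity fun x => ∏ i, f i (x i) := by
  refine Measure.pi_eq fun s hs => ?_
  rw [withDensity_apply _ (MeasurableSet.univ_pi hs),
    ← lintegral_indicator (MeasurableSet.univ_pi hs)]
  have h : (Set.univ.pi s).indicator (fun x : ι → ℝ => ∏ i, f i (x i)) =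
      fun x => ∏ i, (s i).indicator (f i) (x i) := by
    funext x
    by_cases hx : x ∈ Set.univ.pi s
    · rw [Set.indicator_of_mem hx]
      exact Finset.prod_congr rfl fun i _ =>
        (Set.indicator_of_mem (hx i (Set.mem_univ i)) _).symm
    · rw [Set.indicator_of_notMem hx]
      simp only [Set.mem_univ_pi, not_forall] at hx
      obtain ⟨i, hi⟩ := hx
      exact (Finset.prod_eq_zero (Finset.mem_univ i) (Set.indicator_of_notMem hi _)).symm
  rw [h, lintegral_pi_prod fun i => (hf i).indicator (hs i)]
  refine Finset.prod_congr rfl fun i _ => ?_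
  rw [lintegral_indicator (hs i), withDensity_apply _ (hs i)]

/-- Second moment of a sum of independent centred variables. -/
lemma lintegral_sq_sum_pi_le {ι : Type*} [Fintype ι] {μ : ι → Measure ℝ}
    [∀ i, IsProbabilityMeasure (μ i)] {f : ι → ℝ → ℝ} {C : ℝ}
    (hf : ∀ i, MemLp (f i) 2 (μ i)) (h0 : ∀ i, ∫ x, f i x ∂(μ i) = 0)
    (hC : ∀ i, ∫ x, f i x ^ 2 ∂(μ i) ≤ C) :
    ∫⁻ x, ENNReal.ofReal ((∑ i, f i (x i)) ^ 2) ∂(Measure.pi μ) ≤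
      ENNReal.ofReal (Fintype.card ι * C) := by
  have hm : ∀ i, MemLp (fun x : ι → ℝ => f i (x i)) 2 (Measure.pi μ) := fun i =>
    (hf i).comp_measurePreserving (measurePreserving_eval μ i)
  have hs : MemLp (fun x : ι → ℝ => ∑ i, f i (x i)) 2 (Measure.pi μ) :=
    memLp_finsetSum _ fun i _ => hm i
  have hmean : ∫ x, ∑ i, f i (x i) ∂(Measure.pi μ) = 0 := by
    rw [integral_finsetSum _ fun i _ => (hm i).integrable (by norm_num)]
    refine Finset.sum_eq_zero fun i _ => ?_
    rw [integral_comp_eval (hf i).aestronglyMeasurable, h0]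
  rw [← ofReal_integral_eq_lintegral_ofReal hs.integrable_sq (ae_of_all _ fun x => sq_nonneg _)]
  apply ENNReal.ofReal_le_ofReal
  have hv := variance_sum_pi hf
  have e : (∑ i, fun x : ι → ℝ => f i (x i)) = fun x => ∑ i, f i (x i) := by
    funext x; simp
  rw [e, variance_of_integral_eq_zero hs.aestronglyMeasurable.aemeasurable hmean] at hv
  rw [hv]
  calc ∑ i, Var[f i; μ i] ≤ ∑ _i : ι, C := Finset.sum_le_sum fun i _ => by
        rw [variance_of_integral_eq_zero (hf i).aestronglyMeasurable.aemeasurable (h0 i)]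
        exact hC i
    _ = Fintype.card ι * C := by simp

lemma lintegral_sq_sum_pi_le_of_bdd {ι : Type*} [Fintype ι] {μ : ι → Measure ℝ}
    [∀ i, IsProbabilityMeasure (μ i)] {f : ι → ℝ → ℝ} {C : ℝ}
    (hf : ∀ i, Measurable (f i)) (h0 : ∀ i, ∫ x, f i x ∂(μ i) = 0)
    (hC : ∀ i, ∀ᵐ x ∂(μ i), |f i x| ≤ C) :
    ∫⁻ x, ENNReal.ofReal ((∑ i, f i (x i)) ^ 2) ∂(Measure.pi μ) ≤
      ENNReal.ofReal (Fintype.card ι * C ^ 2) := by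
  have hm : ∀ i, MemLp (f i) 2 (μ i) := fun i =>
    MemLp.of_bound (hf i).aestronglyMeasurable C (hC i)
  refine lintegral_sq_sum_pi_le hm h0 fun i => ?_
  calc ∫ x, f i x ^ 2 ∂(μ i) ≤ ∫ _, C ^ 2 ∂(μ i) := by
        refine integral_mono_ae (hm i).integrable_sq (integrable_const _) ?_
        filter_upwards [hC i] with x hx
        exact sq_le_sq' (abs_le.1 hx).1 (abs_le.1 hx).2
    _ = C ^ 2 := by simp

/-! ### Symbols and the posterior -/

instance : IsProbabilityMeasure symbolLaw := by
  constructor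
  simp only [symbolLaw, Measure.smul_apply, Measure.add_apply, measure_univ, smul_eq_mul]
  rw [one_add_one_eq_two, ENNReal.inv_mul_cancel two_ne_zero ENNReal.ofNat_ne_top]

lemma integral_symbolLaw (f : ℝ → ℝ) : ∫ s, f s ∂symbolLaw = (f 1 + f (-1)) / 2 := by
  rw [symbolLaw, integral_smul_measure, integral_add_measure (integrable_dirac (by simp))
    (integrable_dirac (by simp)), integral_dirac, integral_dirac]
  simp
  ring

lemma lintegral_symbolLaw (f : ℝ → ENNReal) :
    ∫⁻ s, f s ∂symbolLaw = 2⁻¹ * (f 1 + f (-1)) := by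
  simp [symbolLaw, lintegral_smul_measure, lintegral_add_measure, mul_add]

lemma ae_symbolLaw {p : ℝ → Prop} (h1 : p 1) (h2 : p (-1)) : ∀ᵐ s ∂symbolLaw, p s := by
  rw [symbolLaw]
  refine Measure.ae_smul_measure ?_ _
  rw [ae_add_measure_iff, ae_dirac_eq, ae_dirac_eq]
  exact ⟨h1, h2⟩

/-- Density of `S = s` given `U = u` with respect to `symbolLaw`. -/
def postDensity (h₁ u s : ℝ) : ENNReal :=
  ENNReal.ofReal (Real.exp (h₁ * s * u) / Real.cosh (h₁ * u))

/-- Conditional law of `S` given `U = u`. -/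
def posterior (h₁ u : ℝ) : Measure ℝ := symbolLaw.withDensity (postDensity h₁ u)

lemma measurable_postDensity (h₁ u : ℝ) : Measurable (postDensity h₁ u) := by
  unfold postDensity
  fun_prop

instance (h₁ u : ℝ) : IsProbabilityMeasure (posterior h₁ u) := by
  constructor
  have hc := Real.cosh_pos (h₁ * u)
  rw [posterior, withDensity_apply _ MeasurableSet.univ, Measure.restrict_univ,
    lintegral_symbolLaw, postDensity, postDensity, ← ENNReal.ofReal_add (by positivity)
    (by positivity), ← add_div]
  have h : (Real.exp (h₁ * 1 * u) + Real.exp (h₁ * -1 * u)) / Real.cosh (h₁ * u) = 2 := by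
    rw [div_eq_iff hc.ne', Real.cosh_eq]
    ring_nf
  rw [h, ENNReal.ofReal_ofNat, ENNReal.inv_mul_cancel two_ne_zero ENNReal.ofNat_ne_top]

/-- The posterior mean of the symbol is $\tanh(h_1u)$; this centres `noiseS`. -/
lemma integral_posterior (h₁ u : ℝ) :
    ∫ s, (s - Real.tanh (h₁ * u)) ∂(posterior h₁ u) = 0 := by
  have hc := Real.cosh_pos (h₁ * u)
  rw [posterior, integral_withDensity_eq_integral_toReal_smul (measurable_postDensity h₁ u)
    (ae_of_all _ fun s => by simp [postDensity]), integral_symbolLaw]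
  have e : ∀ s, (postDensity h₁ u s).toReal = Real.exp (h₁ * s * u) / Real.cosh (h₁ * u) :=
    fun s => ENNReal.toReal_ofReal (by positivity)
  simp only [e, smul_eq_mul]
  rw [Real.tanh_eq_sinh_div_cosh, Real.sinh_eq, Real.cosh_eq]
  rw [Real.cosh_eq] at hc
  field_simp
  ring_nf

/-- Change of variables from the noise to the relay's observation, for a given symbol sequence. -/
lemma lintegral_relay_shift (h₁ : ℝ) {n : ℕ} (s : Seq n) {H : Seq n → ENNReal}
    (hH : Measurable H) :
    ∫⁻ z, H (fun l => h₁ * s l + z l) ∂(Measure.pi fun _ : Fin n => gaussianReal 0 1) =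
      ∫⁻ u, (∏ l, ENNReal.ofReal (Real.exp (h₁ * s l * u l - (h₁ * s l) ^ 2 / 2))) * H u
        ∂(Measure.pi fun _ : Fin n => gaussianReal 0 1) := by
  have hd : ∀ m : ℝ, gaussianReal m 1 = (gaussianReal 0 1).withDensity
      fun u => ENNReal.ofReal (Real.exp (m * u - m ^ 2 / 2)) := by
    intro m
    rw [gaussianReal_of_var_ne_zero _ one_ne_zero, gaussianReal_of_var_ne_zero _ one_ne_zero,
      ← withDensity_mul _ (measurable_gaussianPDF 0 1) (by fun_prop)]
    congr 1
    funext u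
    simp only [gaussianPDF, Pi.mul_apply]
    rw [← ENNReal.ofReal_mul (gaussianPDFReal_nonneg _ _ _), gaussianPDFReal, gaussianPDFReal,
      mul_assoc _ (Real.exp _), ← Real.exp_add]
    congr 3
    push_cast
    ring
  have hmap : (Measure.pi fun _ : Fin n => gaussianReal 0 1).map
      (fun z l => h₁ * s l + z l) = (Measure.pi fun _ : Fin n => gaussianReal 0 1).withDensity
        fun u => ∏ l, ENNReal.ofReal (Real.exp (h₁ * s l * u l - (h₁ * s l) ^ 2 / 2)) := by
    have hm : ∀ l, (gaussianReal 0 1).map (fun z => h₁ * s l + z) =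
        gaussianReal (h₁ * s l) 1 := fun l => by
      rw [gaussianReal_map_const_add, zero_add]
    have hp : ∀ l, IsProbabilityMeasure ((gaussianReal 0 1).map (fun z => h₁ * s l + z)) :=
      fun l => by rw [hm]; infer_instance
    have hp' : ∀ l, IsProbabilityMeasure ((gaussianReal 0 1).withDensity
        fun u => ENNReal.ofReal (Real.exp (h₁ * s l * u - (h₁ * s l) ^ 2 / 2))) :=
      fun l => by rw [← hd]; infer_instance
    rw [Measure.pi_map_pi (f := fun l z => h₁ * s l + z) fun l => by fun_prop,
      ← pi_withDensity (μ := fun _ : Fin n => gaussianReal 0 1)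
        (f := fun l u => ENNReal.ofReal (Real.exp (h₁ * s l * u - (h₁ * s l) ^ 2 / 2)))
        fun l => by fun_prop]
    congr 1
    funext l
    rw [hm, hd]
  rw [← lintegral_map hH (by fun_prop), hmap, lintegral_withDensity_eq_lintegral_mul _
    (by fun_prop) hH]
  rfl

/-- Total weight of an observation under the tilted law. -/
def obsWeight (h₁ u : ℝ) : ENNReal := ENNReal.ofReal (Real.exp (-h₁ ^ 2 / 2) * Real.cosh (h₁ * u))

lemma ae_pi_symbolLaw (n : ℕ) :
    ∀ᵐ s ∂(Measure.pi fun _ : Fin n => symbolLaw), ∀ l, s l ^ 2 = 1 := by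
  rw [ae_all_iff]
  intro l
  exact (measurePreserving_eval (fun _ : Fin n => symbolLaw) l).quasiMeasurePreserving.ae
    (ae_symbolLaw (p := fun s => s ^ 2 = 1) (by norm_num) (by norm_num))

/-- Bayes' rule for sequences: symbols given the relay's observation are independent, with law
`posterior`. -/
lemma lintegral_symbol_relay (h₁ : ℝ) {n : ℕ} {H : Seq n → Seq n → ENNReal}
    (hH : Measurable (Function.uncurry H)) :
    ∫⁻ s, ∫⁻ z, H s (fun l => h₁ * s l + z l) ∂(Measure.pi fun _ : Fin n => gaussianReal 0 1)
        ∂(Measure.pi fun _ : Fin n => symbolLaw) =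
      ∫⁻ u, (∏ l, obsWeight h₁ (u l)) * ∫⁻ s, H s u ∂(Measure.pi fun l => posterior h₁ (u l))
        ∂(Measure.pi fun _ : Fin n => gaussianReal 0 1) := by
  have hH' : Measurable fun p : Seq n × Seq n => H p.1 p.2 := hH
  have h1 : ∀ s : Seq n, Measurable fun u => H s u := fun s => hH'.comp measurable_prodMk_left
  have h2 : ∀ u : Seq n, Measurable fun s => H s u := fun u => hH'.comp measurable_prodMk_right
  -- Once each shift is a density against one and the same Gaussian law, the integrals over symbols
  -- and observations can be exchanged.
  simp_rw [fun s => lintegral_relay_shift h₁ s (h1 s)]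
  rw [lintegral_lintegral_swap (by
    apply Measurable.aemeasurable
    simp only [Function.uncurry_def]
    fun_prop)]
  refine lintegral_congr fun u => ?_
  have hp : ∀ l, IsProbabilityMeasure (symbolLaw.withDensity (postDensity h₁ (u l))) :=
    fun l => inferInstanceAs (IsProbabilityMeasure (posterior h₁ (u l)))
  have hpi : (Measure.pi fun l => posterior h₁ (u l)) =
      (Measure.pi fun _ : Fin n => symbolLaw).withDensity
        fun s => ∏ l, postDensity h₁ (u l) (s l) :=
    pi_withDensity (μ := fun _ : Fin n => symbolLaw) (f := fun l => postDensity h₁ (u l))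
      fun l => measurable_postDensity h₁ (u l)
  have hm : Measurable fun s : Seq n => ∏ l, postDensity h₁ (u l) (s l) := by
    unfold postDensity; fun_prop
  rw [hpi, lintegral_withDensity_eq_lintegral_mul _ hm (h2 u),
    ← lintegral_const_mul _ (hm.mul (h2 u))]
  refine lintegral_congr_ae ?_
  -- Since $s_l^2=1$, the factor $e^{-(h_1s_l)^2/2}$ does not depend on the symbol and goes into
  -- `obsWeight`.
  filter_upwards [ae_pi_symbolLaw n] with s hs
  simp only [Pi.mul_apply]
  rw [← mul_assoc, ← Finset.prod_mul_distrib]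
  congr 1
  refine Finset.prod_congr rfl fun l _ => ?_
  have hc := Real.cosh_pos (h₁ * u l)
  rw [obsWeight, postDensity, ← ENNReal.ofReal_mul (by positivity)]
  congr 1
  rw [mul_pow, hs l, sub_eq_add_neg, Real.exp_add]
  field_simp

/-! ### Integration over the network -/

instance (n : ℕ) : IsProbabilityMeasure (primitiveLaw n) := by
  unfold primitiveLaw
  infer_instance

instance (h₁ : ℝ) {n : ℕ} (K : Kernel (Seq n) (Seq n)) [IsMarkovKernel K] :
    IsProbabilityMeasure (networkLaw h₁ K) := by
  unfold networkLaw
  infer_instance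

/-- The relay's output depends on $S$ and $N_r$ only, so the destination noises can be integrated
innermost, with everything else held fixed. -/
lemma lintegral_networkLaw (h₁ : ℝ) {n : ℕ} (K : Kernel (Seq n) (Seq n)) [IsMarkovKernel K]
    {F : Primitive n × Seq n → ENNReal} (hF : Measurable F) :
    ∫⁻ ω, F ω ∂(networkLaw h₁ K) =
      ∫⁻ s, ∫⁻ z, ∫⁻ v, ∫⁻ a, ∫⁻ b, F ((s, z, a, b), v)
        ∂(Measure.pi fun _ : Fin n => gaussianReal 0 1)
        ∂(Measure.pi fun _ : Fin n => gaussianReal 0 1)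
        ∂(K fun l => h₁ * s l + z l)
        ∂(Measure.pi fun _ : Fin n => gaussianReal 0 1)
        ∂(Measure.pi fun _ : Fin n => symbolLaw) := by
  set κ := K.comap (relayInput h₁) (measurable_relayInput h₁ n) with hκ
  have hG : Measurable fun w : Primitive n => ∫⁻ v, F (w, v) ∂(κ w) :=
    hF.lintegral_kernel_prod_right'
  rw [networkLaw, Measure.lintegral_compProd hF, primitiveLaw, lintegral_prod _ hG.aemeasurable]
  refine lintegral_congr fun s => ?_
  have hG1 : Measurable fun w : Seq n × Seq n × Seq n => ∫⁻ v, F ((s, w), v) ∂(κ (s, w)) :=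
    hG.comp measurable_prodMk_left
  rw [lintegral_prod _ hG1.aemeasurable]
  refine lintegral_congr fun z => ?_
  have hG2 : Measurable fun w : Seq n × Seq n => ∫⁻ v, F ((s, z, w), v) ∂(κ (s, z, w)) :=
    hG1.comp measurable_prodMk_left
  rw [lintegral_prod _ hG2.aemeasurable]
  have hK : ∀ a b, κ (s, z, a, b) = K fun l => h₁ * s l + z l := fun a b => rfl
  simp_rw [hK]
  have hF1 : Measurable fun p : (Seq n × Seq n) × Seq n => F ((s, z, p.1.1, p.1.2), p.2) :=
    hF.comp (by fun_prop)
  rw [lintegral_lintegral_swap (μ := K fun l => h₁ * s l + z l) (by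
    apply Measurable.aemeasurable
    have : Measurable fun q : (Seq n × Seq n) × Seq n => F ((s, z, q.1.2, q.2), q.1.1) :=
      hF.comp (by fun_prop)
    exact this.lintegral_prod_right')]
  refine lintegral_congr fun a => ?_
  rw [lintegral_lintegral_swap]
  apply Measurable.aemeasurable
  exact hF.comp (f := fun q : Seq n × Seq n => ((s, z, a, q.1), q.2)) (by fun_prop)

/-- Law of a single observation of the relay. -/
def obsLaw (h₁ : ℝ) : Measure ℝ := (gaussianReal 0 1).withDensity (obsWeight h₁)

lemma measurable_obsWeight (h₁ : ℝ) : Measurable (obsWeight h₁) := by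
  have := Real.continuous_cosh.measurable
  unfold obsWeight
  fun_prop

instance (h₁ : ℝ) : IsProbabilityMeasure (obsLaw h₁) := by
  constructor
  have hi : ∀ t : ℝ, Integrable (fun u => Real.exp (t * u)) (gaussianReal 0 1) :=
    integrable_exp_mul_gaussianReal
  have hm : ∀ t : ℝ, ∫ u, Real.exp (t * u) ∂(gaussianReal 0 1) = Real.exp (t ^ 2 / 2) := by
    intro t
    have := congrFun (mgf_fun_id_gaussianReal (μ := 0) (v := 1)) t
    rw [mgf] at this
    simpa using this
  have e : ∀ u, Real.exp (-h₁ ^ 2 / 2) * Real.cosh (h₁ * u) =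
      Real.exp (-h₁ ^ 2 / 2) / 2 * (Real.exp (h₁ * u) + Real.exp (-h₁ * u)) := fun u => by
    rw [Real.cosh_eq]; ring_nf
  rw [obsLaw, withDensity_apply _ MeasurableSet.univ, Measure.restrict_univ]
  unfold obsWeight
  simp_rw [e]
  rw [← ofReal_integral_eq_lintegral_ofReal (f := fun u => Real.exp (-h₁ ^ 2 / 2) / 2 *
      (Real.exp (h₁ * u) + Real.exp (-h₁ * u))) (((hi _).add (hi _)).const_mul _)
    (ae_of_all _ fun u => by simp only [Pi.zero_apply]; positivity), integral_const_mul,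
    integral_add (hi _) (hi _), hm, hm, neg_sq, ← two_mul, ← mul_assoc, div_mul_cancel₀ _
    two_ne_zero, ← Real.exp_add]
  simp [neg_div]

/-- Ensures that boundaries of cells carry no observation mass. -/
lemma obsLaw_absolutelyContinuous (h₁ : ℝ) : obsLaw h₁ ≪ volume :=
  (withDensity_absolutelyContinuous _ _).trans (gaussianReal_absolutelyContinuous 0 one_ne_zero)

/-- The density is positive everywhere, so every cell of positive length is visited with positive
frequency. -/
lemma absolutelyContinuous_obsLaw (h₁ : ℝ) : volume ≪ obsLaw h₁ := by
  refine (gaussianReal_absolutelyContinuous' 0 one_ne_zero).trans ?_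
  refine withDensity_absolutelyContinuous' (measurable_obsWeight h₁).aemeasurable
    (ae_of_all _ fun u => ?_)
  have := Real.cosh_pos (h₁ * u)
  rw [obsWeight, ne_eq, ENNReal.ofReal_eq_zero, not_le]
  positivity

lemma lintegral_seqU (h₁ : ℝ) {n : ℕ} (K : Kernel (Seq n) (Seq n)) [IsMarkovKernel K]
    {H : Seq n → ENNReal} (hH : Measurable H) :
    ∫⁻ ω, H (seqU h₁ ω) ∂(networkLaw h₁ K) =
      ∫⁻ u, H u ∂(Measure.pi fun _ : Fin n => obsLaw h₁) := by
  have hm : Measurable fun ω : Primitive n × Seq n => H (seqU h₁ ω) :=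
    hH.comp ((measurable_relayInput h₁ n).comp measurable_fst)
  rw [lintegral_networkLaw h₁ K hm]
  have hr : ∀ (s z a b v : Seq n), seqU h₁ ((s, z, a, b), v) = fun l => h₁ * s l + z l :=
    fun _ _ _ _ _ => rfl
  simp only [hr, lintegral_const, measure_univ, mul_one]
  rw [lintegral_symbol_relay h₁ (H := fun _ u => H u) (hH.comp measurable_snd)]
  have hp : IsProbabilityMeasure ((gaussianReal 0 1).withDensity (obsWeight h₁)) :=
    inferInstanceAs (IsProbabilityMeasure (obsLaw h₁))
  have hpi : (Measure.pi fun _ : Fin n => obsLaw h₁) =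
      (Measure.pi fun _ : Fin n => gaussianReal 0 1).withDensity
        fun u => ∏ l, obsWeight h₁ (u l) :=
    pi_withDensity (μ := fun _ : Fin n => gaussianReal 0 1) (f := fun _ => obsWeight h₁)
      fun _ => measurable_obsWeight h₁
  have hw : Measurable fun u : Seq n => ∏ l, obsWeight h₁ (u l) := by
    have := measurable_obsWeight h₁
    fun_prop
  rw [hpi, lintegral_withDensity_eq_lintegral_mul _ hw hH]
  simp [Pi.mul_apply]

/-! ### Laws of large numbers -/

/-- Chebyshev's inequality, on a probability space that changes with $n$: a second moment of order
$n$ makes the average vanish in measure. -/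
lemma tendsto_of_second_moment {Ω : ℕ → Type*} [∀ n, MeasurableSpace (Ω n)]
    (μ : ∀ n, Measure (Ω n)) (W : ∀ n, Ω n → ℝ) (hW : ∀ n, Measurable (W n)) (C : ℝ)
    (h : ∀ n, ∫⁻ ω, ENNReal.ofReal (W n ω ^ 2) ∂(μ n) ≤ ENNReal.ofReal (n * C))
    {r : ℝ} (hr : 0 < r) :
    Tendsto (fun n => μ n {ω | r ≤ |W n ω / n|}) atTop (𝓝 0) := by
  have hlim : Tendsto (fun n : ℕ => ENNReal.ofReal (C / r ^ 2 / n)) atTop (𝓝 0) := by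
    rw [← ENNReal.ofReal_zero]
    exact ENNReal.tendsto_ofReal (tendsto_const_div_atTop_nhds_zero_nat _)
  refine tendsto_of_tendsto_of_tendsto_of_le_of_le' tendsto_const_nhds hlim
    (Eventually.of_forall fun n => zero_le) ?_
  filter_upwards [eventually_gt_atTop 0] with n hn
  have hn' : (0 : ℝ) < n := Nat.cast_pos.2 hn
  have h1 := (mul_meas_ge_le_lintegral (μ := μ n) (f := fun ω => ENNReal.ofReal (W n ω ^ 2))
    (by have := hW n; fun_prop) (ENNReal.ofReal ((r * n) ^ 2))).trans (h n)
  have hsub : {ω | r ≤ |W n ω / n|} ⊆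
      {ω | ENNReal.ofReal ((r * n) ^ 2) ≤ ENNReal.ofReal (W n ω ^ 2)} := by
    intro ω hω
    simp only [Set.mem_ofPred_eq] at hω ⊢
    rw [abs_div, abs_of_pos hn', le_div_iff₀ hn'] at hω
    apply ENNReal.ofReal_le_ofReal
    rw [← sq_abs (W n ω)]
    exact pow_le_pow_left₀ (by positivity) hω 2
  have hpos : 0 < (r * n) ^ 2 := by positivity
  refine (measure_mono hsub).trans ?_
  have h2 : ENNReal.ofReal (C / r ^ 2 / n) =
      ENNReal.ofReal (n * C) / ENNReal.ofReal ((r * n) ^ 2) := by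
    rw [← ENNReal.ofReal_div_of_pos hpos]
    congr 1
    field_simp
  rw [h2, ENNReal.le_div_iff_mul_le (Or.inl (ENNReal.ofReal_pos.2 hpos).ne') (Or.inl ENNReal.ofReal_ne_top),
    mul_comm]
  exact h1

/-- The relay's inputs are i.i.d. under every attack, since the attack acts only after them. -/
lemma tendsto_mean_seqU (h₁ : ℝ) (K : ∀ n : ℕ, Kernel (Seq n) (Seq n))
    [∀ n, IsMarkovKernel (K n)] {f : ℝ → ℝ} (hf : Measurable f) {M : ℝ} (hM : ∀ u, |f u| ≤ M)
    {r : ℝ} (hr : 0 < r) :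
    Tendsto (fun n => networkLaw h₁ (K n)
      {ω | r ≤ |(∑ l, f (seqU h₁ ω l)) / n - ∫ u, f u ∂(obsLaw h₁)|}) atTop (𝓝 0) := by
  set m := ∫ u, f u ∂(obsLaw h₁) with hm
  have hint : Integrable f (obsLaw h₁) :=
    Integrable.of_bound hf.aestronglyMeasurable M (ae_of_all _ hM)
  have hU : ∀ n, Measurable (seqU h₁ : Primitive n × Seq n → Seq n) := fun n =>
    (measurable_relayInput h₁ n).comp measurable_fst
  have key := tendsto_of_second_moment (fun n => networkLaw h₁ (K n))
    (fun n ω => ∑ l, (f (seqU h₁ ω l) - m))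
    (fun n => by
      refine Finset.measurable_sum _ fun l _ => ?_
      exact (hf.comp ((measurable_pi_apply l).comp (hU n))).sub_const m) ((M + |m|) ^ 2)
    (fun n => by
      rw [lintegral_seqU h₁ (K n) (H := fun u => ENNReal.ofReal ((∑ l, (f (u l) - m)) ^ 2))
        (by fun_prop)]
      have := lintegral_sq_sum_pi_le_of_bdd (ι := Fin n) (μ := fun _ => obsLaw h₁)
        (f := fun _ u => f u - m) (C := M + |m|) (fun _ => hf.sub_const m)
        (fun _ => by rw [integral_sub hint (integrable_const _)]; simp [hm])
        (fun _ => ae_of_all _ fun u => (abs_sub _ _).trans (by linarith [hM u]))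
      simpa using this) hr
  refine key.congr' ?_
  filter_upwards [eventually_gt_atTop 0] with n hn
  have hn' : (n : ℝ) ≠ 0 := Nat.cast_ne_zero.2 hn.ne'
  congr 1
  ext ω
  simp only [Set.mem_ofPred_eq, Finset.sum_sub_distrib, Finset.sum_const, Finset.card_univ,
    Fintype.card_fin, nsmul_eq_mul, sub_div, mul_div_cancel_left₀ _ hn']

/-! ### The decision statistic -/

/-- Indicator of `a ≤ y`. -/
def belowInd (y a : ℝ) : ℝ := (Set.Iic y).indicator (fun _ => (1 : ℝ)) a

@[fun_prop]
lemma measurable_belowInd (y : ℝ) : Measurable (belowInd y) :=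
  measurable_const.indicator measurableSet_Iic

lemma belowInd_nonneg (y a : ℝ) : 0 ≤ belowInd y a := Set.indicator_nonneg (by simp) _

lemma belowInd_le_one (y a : ℝ) : belowInd y a ≤ 1 :=
  Set.indicator_le_self' (fun _ _ => zero_le_one) _

lemma integral_belowInd (h₂ y v : ℝ) :
    ∫ z, belowInd y (h₂ * v + z) ∂(gaussianReal 0 1) = FYV h₂ y v :=
  integral_indicator_Iic_add h₂ y v

lemma integrable_belowInd (h₂ y v : ℝ) :
    Integrable (fun z => belowInd y (h₂ * v + z)) (gaussianReal 0 1) :=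
  Integrable.of_bound (by fun_prop : Measurable _).aestronglyMeasurable 1 (ae_of_all _ fun z => by
    rw [Real.norm_eq_abs, abs_of_nonneg (belowInd_nonneg _ _)]; exact belowInd_le_one _ _)

/-- Test function of a received pair, with conditional mean `regr` given the relay's input and
output. -/
def testFn (h₁ h₂ h₃ x y : ℝ) : ℝ :=
  (belowInd (h₁ / h₂) y - belowInd (-(h₁ / h₂)) y) -
    x / h₃ * (belowInd (h₁ / h₂) y + belowInd (-(h₁ / h₂)) y)

/-- Decision statistic: the signed deviation of the empirical mean of `testFn` from its mean under
faithful forwarding. -/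
def statistic (h₁ h₂ h₃ : ℝ) (n : ℕ) (x y : Seq n) : ℝ :=
  -(h₁ * h₂) * ((∑ l, testFn h₁ h₂ h₃ (x l) (y l)) / n - ∫ u, regr h₁ h₂ u u ∂(obsLaw h₁))

lemma measurable_testFn (h₁ h₂ h₃ : ℝ) : Measurable fun p : ℝ × ℝ => testFn h₁ h₂ h₃ p.1 p.2 := by
  unfold testFn
  fun_prop

lemma measurable_statistic (h₁ h₂ h₃ : ℝ) (n : ℕ) :
    Measurable (Function.uncurry (statistic h₁ h₂ h₃ n)) := by
  have h : ∀ l : Fin n, Measurable fun p : Seq n × Seq n => testFn h₁ h₂ h₃ (p.1 l) (p.2 l) :=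
    fun l => (measurable_testFn h₁ h₂ h₃).comp
      (f := fun p : Seq n × Seq n => (p.1 l, p.2 l)) (by fun_prop)
  simp only [Function.uncurry_def, statistic]
  exact (((Finset.measurable_sum _ fun l _ => h l).div_const _).sub_const _).const_mul _

@[fun_prop]
lemma measurable_FYV (h₂ y : ℝ) : Measurable (FYV h₂ y) := (continuous_FYV h₂ y).measurable

@[fun_prop]
lemma measurable_tanh : Measurable Real.tanh := continuous_tanh.measurable

@[fun_prop]
lemma measurable_seqU (h₁ : ℝ) (n : ℕ) : Measurable (seqU h₁ : Primitive n × Seq n → Seq n) :=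
  (measurable_relayInput h₁ n).comp measurable_fst

@[fun_prop]
lemma measurable_seqV (n : ℕ) : Measurable (seqV : Primitive n × Seq n → Seq n) := measurable_snd

@[fun_prop]
lemma measurable_seqX (h₃ : ℝ) (n : ℕ) : Measurable (seqX h₃ : Primitive n × Seq n → Seq n) := by
  unfold seqX
  fun_prop

@[fun_prop]
lemma measurable_seqY (h₂ : ℝ) (n : ℕ) : Measurable (seqY h₂ : Primitive n × Seq n → Seq n) := by
  unfold seqY
  fun_prop

/-- Fluctuation due to the noise in `Y`. -/
def noiseY (h₁ h₂ : ℝ) {n : ℕ} (ω : Primitive n × Seq n) (l : Fin n) : ℝ :=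
  (belowInd (h₁ / h₂) (seqY h₂ ω l) - belowInd (-(h₁ / h₂)) (seqY h₂ ω l) -
      (FYV h₂ (h₁ / h₂) (seqV ω l) - FYV h₂ (-(h₁ / h₂)) (seqV ω l))) -
    ω.1.1 l * (belowInd (h₁ / h₂) (seqY h₂ ω l) + belowInd (-(h₁ / h₂)) (seqY h₂ ω l) -
      (FYV h₂ (h₁ / h₂) (seqV ω l) + FYV h₂ (-(h₁ / h₂)) (seqV ω l)))

/-- Fluctuation due to the noise in `X`. -/
def noiseX (h₁ h₂ h₃ : ℝ) {n : ℕ} (ω : Primitive n × Seq n) (l : Fin n) : ℝ :=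
  ω.1.2.2.1 l *
    ((belowInd (h₁ / h₂) (seqY h₂ ω l) + belowInd (-(h₁ / h₂)) (seqY h₂ ω l)) / h₃)

/-- Fluctuation due to the symbols given the relay's input. -/
def noiseS (h₁ h₂ : ℝ) {n : ℕ} (ω : Primitive n × Seq n) (l : Fin n) : ℝ :=
  (ω.1.1 l - Real.tanh (h₁ * seqU h₁ ω l)) *
    (FYV h₂ (h₁ / h₂) (seqV ω l) + FYV h₂ (-(h₁ / h₂)) (seqV ω l))

/-- The three noise terms come from replacing in turn $X/h_3$ by $S$, the indicators of $Y$ by their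
means given $V$, and $S$ by its mean given $U$. -/
lemma testFn_eq {h₁ h₂ h₃ : ℝ} (hh₃ : h₃ ≠ 0) {n : ℕ} (ω : Primitive n × Seq n) (l : Fin n) :
    testFn h₁ h₂ h₃ (seqX h₃ ω l) (seqY h₂ ω l) = regr h₁ h₂ (seqU h₁ ω l) (seqV ω l) +
      noiseY h₁ h₂ ω l - noiseX h₁ h₂ h₃ ω l - noiseS h₁ h₂ ω l := by
  rw [testFn, regr, noiseY, noiseX, noiseS, seqX]
  field_simp
  ring

/-- For fixed symbols and fixed $V$, the summands are independent and centred in the noise of $Y$,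
however $V$ was produced. -/
lemma lintegral_noiseY_le (h₁ h₂ : ℝ) {n : ℕ} (K : Kernel (Seq n) (Seq n)) [IsMarkovKernel K] :
    ∫⁻ ω, ENNReal.ofReal ((∑ l, noiseY h₁ h₂ ω l) ^ 2) ∂(networkLaw h₁ K) ≤
      ENNReal.ofReal (n * 4 ^ 2) := by
  rw [lintegral_networkLaw h₁ K (by unfold noiseY; fun_prop)]
  refine (lintegral_mono_ae (g := fun _ => ENNReal.ofReal (n * 4 ^ 2)) ?_).trans (by simp)
  filter_upwards [ae_pi_symbolLaw n] with s hs
  refine (lintegral_mono (g := fun _ => ENNReal.ofReal (n * 4 ^ 2)) fun z => ?_).trans (by simp)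
  refine (lintegral_mono (g := fun _ => ENNReal.ofReal (n * 4 ^ 2)) fun v => ?_).trans (by simp)
  refine (lintegral_mono (g := fun _ => ENNReal.ofReal (n * 4 ^ 2)) fun a => ?_).trans (by simp)
  have key := lintegral_sq_sum_pi_le_of_bdd (ι := Fin n) (μ := fun _ => gaussianReal 0 1) (C := 4)
    (f := fun l b =>
      (belowInd (h₁ / h₂) (h₂ * v l + b) - belowInd (-(h₁ / h₂)) (h₂ * v l + b) -
        (FYV h₂ (h₁ / h₂) (v l) - FYV h₂ (-(h₁ / h₂)) (v l))) -
      s l * (belowInd (h₁ / h₂) (h₂ * v l + b) + belowInd (-(h₁ / h₂)) (h₂ * v l + b) -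
        (FYV h₂ (h₁ / h₂) (v l) + FYV h₂ (-(h₁ / h₂)) (v l))))
    (fun l => by fun_prop) (fun l => ?_) (fun l => ae_of_all _ fun b => ?_)
  · rw [Fintype.card_fin] at key
    exact key
  · have i : ∀ y, Integrable (fun b => belowInd y (h₂ * v l + b) - FYV h₂ y (v l))
        (gaussianReal 0 1) := fun y => (integrable_belowInd h₂ y (v l)).sub (integrable_const _)
    have i0 : ∀ y, ∫ b, (belowInd y (h₂ * v l + b) - FYV h₂ y (v l)) ∂(gaussianReal 0 1) = 0 := by
      intro y
      rw [integral_sub (integrable_belowInd h₂ y (v l)) (integrable_const _), integral_belowInd]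
      simp
    -- Grouping by threshold leaves two centred indicators with constant coefficients $1\mp s_l$.
    calc _ = ∫ b, ((1 - s l) * (belowInd (h₁ / h₂) (h₂ * v l + b) - FYV h₂ (h₁ / h₂) (v l)) -
          (1 + s l) * (belowInd (-(h₁ / h₂)) (h₂ * v l + b) - FYV h₂ (-(h₁ / h₂)) (v l)))
          ∂(gaussianReal 0 1) := integral_congr_ae (ae_of_all _ fun b => by ring)
      _ = 0 := by
        rw [integral_sub ((i _).const_mul _) ((i _).const_mul _), integral_const_mul,
          integral_const_mul, i0, i0]
        simp
  · have hs1 : |s l| ≤ 1 := by rw [← sq_le_one_iff_abs_le_one]; exact (hs l).le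
    have hp0 := belowInd_nonneg (h₁ / h₂) (h₂ * v l + b)
    have hp1 := belowInd_le_one (h₁ / h₂) (h₂ * v l + b)
    have hm0 := belowInd_nonneg (-(h₁ / h₂)) (h₂ * v l + b)
    have hm1 := belowInd_le_one (-(h₁ / h₂)) (h₂ * v l + b)
    have fp0 := FYV_nonneg h₂ (h₁ / h₂) (v l)
    have fp1 := FYV_le_one h₂ (h₁ / h₂) (v l)
    have fm0 := FYV_nonneg h₂ (-(h₁ / h₂)) (v l)
    have fm1 := FYV_le_one h₂ (-(h₁ / h₂)) (v l)
    refine (abs_sub _ _).trans ?_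
    rw [abs_mul]
    have h1 : |belowInd (h₁ / h₂) (h₂ * v l + b) - belowInd (-(h₁ / h₂)) (h₂ * v l + b) -
        (FYV h₂ (h₁ / h₂) (v l) - FYV h₂ (-(h₁ / h₂)) (v l))| ≤ 2 := by
      rw [abs_le]; constructor <;> linarith
    have h2 : |belowInd (h₁ / h₂) (h₂ * v l + b) + belowInd (-(h₁ / h₂)) (h₂ * v l + b) -
        (FYV h₂ (h₁ / h₂) (v l) + FYV h₂ (-(h₁ / h₂)) (v l))| ≤ 2 := by
      rw [abs_le]; constructor <;> linarith
    have := mul_le_mul hs1 h2 (abs_nonneg _) zero_le_one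
    linarith

/-- The noise of $X$ is independent of $Y$. Integrating it after fixing the noise of $Y$ makes the
bracket a constant coefficient of a centred Gaussian. -/
lemma lintegral_noiseX_le (h₁ h₂ h₃ : ℝ) {n : ℕ} (K : Kernel (Seq n) (Seq n))
    [IsMarkovKernel K] :
    ∫⁻ ω, ENNReal.ofReal ((∑ l, noiseX h₁ h₂ h₃ ω l) ^ 2) ∂(networkLaw h₁ K) ≤
      ENNReal.ofReal (n * (2 / |h₃|) ^ 2) := by
  have hmeas : Measurable fun ω : Primitive n × Seq n =>
      ENNReal.ofReal ((∑ l, noiseX h₁ h₂ h₃ ω l) ^ 2) := by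
    unfold noiseX; fun_prop
  set c := ENNReal.ofReal (n * (2 / |h₃|) ^ 2) with hc
  rw [lintegral_networkLaw h₁ K hmeas]
  refine (lintegral_mono (g := fun _ => c) fun s => ?_).trans (by simp)
  refine (lintegral_mono (g := fun _ => c) fun z => ?_).trans (by simp)
  refine (lintegral_mono (g := fun _ => c) fun v => ?_).trans (by simp)
  dsimp only
  rw [lintegral_lintegral_swap (by
    apply Measurable.aemeasurable
    exact hmeas.comp (f := fun q : Seq n × Seq n => ((s, z, q.1, q.2), v)) (by fun_prop))]
  refine (lintegral_mono (g := fun _ => c) fun b => ?_).trans (by simp)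
  set k : Fin n → ℝ := fun l =>
    (belowInd (h₁ / h₂) (h₂ * v l + b l) + belowInd (-(h₁ / h₂)) (h₂ * v l + b l)) / h₃ with hk
  have hkb : ∀ l, k l ^ 2 ≤ (2 / |h₃|) ^ 2 := fun l => by
    have hp0 := belowInd_nonneg (h₁ / h₂) (h₂ * v l + b l)
    have hp1 := belowInd_le_one (h₁ / h₂) (h₂ * v l + b l)
    have hm0 := belowInd_nonneg (-(h₁ / h₂)) (h₂ * v l + b l)
    have hm1 := belowInd_le_one (-(h₁ / h₂)) (h₂ * v l + b l)
    rw [hk, div_pow, div_pow, sq_abs]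
    exact div_le_div_of_nonneg_right (by nlinarith) (sq_nonneg _)
  have hid : MemLp (fun x : ℝ => x) 2 (gaussianReal 0 1) := memLp_id_gaussianReal 2
  have hsq : ∫ x : ℝ, x ^ 2 ∂(gaussianReal 0 1) = 1 := by
    have := variance_fun_id_gaussianReal (μ := 0) (v := 1)
    rw [variance_of_integral_eq_zero (X := fun x : ℝ => x) measurable_id.aemeasurable integral_id_gaussianReal] at this
    simpa using this
  have key := lintegral_sq_sum_pi_le (ι := Fin n) (μ := fun _ => gaussianReal 0 1)
    (C := (2 / |h₃|) ^ 2) (f := fun l a => a * k l) (fun l => hid.mul_const _)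
    (fun l => by rw [integral_mul_const, integral_id_gaussianReal, zero_mul])
    (fun l => by simp_rw [mul_pow]; rw [integral_mul_const, hsq, one_mul]; exact hkb l)
  rw [Fintype.card_fin] at key
  exact key

lemma ae_posterior (h₁ u : ℝ) : ∀ᵐ s ∂(posterior h₁ u), |s| ≤ 1 :=
  (withDensity_absolutelyContinuous _ _).ae_le
    (ae_symbolLaw (p := fun s => |s| ≤ 1) (by norm_num) (by norm_num))

/-- The attack may mix all coordinates of $U$, yet given $U^n$ the output is independent of $S^n$,
whose coordinates are independent by Bayes' rule. So for fixed $U^n,V^n$ the summands are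
independent and centred. -/
lemma lintegral_noiseS_le (h₁ h₂ : ℝ) {n : ℕ} (K : Kernel (Seq n) (Seq n)) [IsMarkovKernel K] :
    ∫⁻ ω, ENNReal.ofReal ((∑ l, noiseS h₁ h₂ ω l) ^ 2) ∂(networkLaw h₁ K) ≤
      ENNReal.ofReal (n * 4 ^ 2) := by
  rw [lintegral_networkLaw h₁ K (by unfold noiseS; fun_prop)]
  have hr : ∀ (s z a b v : Seq n), seqU h₁ ((s, z, a, b), v) = fun l => h₁ * s l + z l :=
    fun _ _ _ _ _ => rfl
  simp only [noiseS, seqV, hr, lintegral_const, measure_univ, mul_one]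
  set B : ℝ → ℝ := fun w => FYV h₂ (h₁ / h₂) w + FYV h₂ (-(h₁ / h₂)) w with hB
  have hBm : Measurable B := by fun_prop
  have hF : Measurable fun q : (Seq n × Seq n) × Seq n =>
      ENNReal.ofReal ((∑ l, (q.1.1 l - Real.tanh (h₁ * q.1.2 l)) * B (q.2 l)) ^ 2) := by
    fun_prop
  have hH : Measurable (Function.uncurry fun s u : Seq n =>
      ∫⁻ v, ENNReal.ofReal ((∑ l, (s l - Real.tanh (h₁ * u l)) * B (v l)) ^ 2) ∂(K u)) :=
    hF.lintegral_kernel_prod_right' (κ := K.comap Prod.snd measurable_snd)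
  rw [lintegral_symbol_relay h₁ hH]
  have hbound : ∀ u : Seq n, ∫⁻ s, ∫⁻ v,
      ENNReal.ofReal ((∑ l, (s l - Real.tanh (h₁ * u l)) * B (v l)) ^ 2) ∂(K u)
      ∂(Measure.pi fun l => posterior h₁ (u l)) ≤ ENNReal.ofReal (n * 4 ^ 2) := by
    intro u
    rw [lintegral_lintegral_swap (by
      apply Measurable.aemeasurable
      exact hF.comp (f := fun q : Seq n × Seq n => ((q.1, u), q.2)) (by fun_prop))]
    refine (lintegral_mono (g := fun _ => ENNReal.ofReal (n * 4 ^ 2)) fun v => ?_).trans (by simp)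
    have key := lintegral_sq_sum_pi_le_of_bdd (ι := Fin n) (μ := fun l => posterior h₁ (u l))
      (f := fun l s => (s - Real.tanh (h₁ * u l)) * B (v l)) (C := 4) (fun l => by fun_prop)
      (fun l => by rw [integral_mul_const, integral_posterior, zero_mul])
      (fun l => by
        filter_upwards [ae_posterior h₁ (u l)] with s hs
        have h0 : 0 ≤ B (v l) := add_nonneg (FYV_nonneg _ _ _) (FYV_nonneg _ _ _)
        have h1 : B (v l) ≤ 2 := by
          have := FYV_le_one h₂ (h₁ / h₂) (v l)
          have := FYV_le_one h₂ (-(h₁ / h₂)) (v l)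
          simp only [hB]
          linarith
        have h2 : |s - Real.tanh (h₁ * u l)| ≤ 2 :=
          (abs_sub _ _).trans (by linarith [abs_tanh_le_one (h₁ * u l)])
        rw [abs_mul, abs_of_nonneg h0]
        nlinarith [abs_nonneg (s - Real.tanh (h₁ * u l))])
    simpa only [Fintype.card_fin] using key
  have hw : ∫⁻ u, obsWeight h₁ u ∂(gaussianReal 0 1) = 1 := by
    have := measure_univ (μ := obsLaw h₁)
    rwa [obsLaw, withDensity_apply _ MeasurableSet.univ, Measure.restrict_univ] at this
  calc _ ≤ ∫⁻ u, (∏ l, obsWeight h₁ (u l)) * ENNReal.ofReal (n * 4 ^ 2)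
        ∂(Measure.pi fun _ : Fin n => gaussianReal 0 1) :=
        lintegral_mono fun u => mul_le_mul_right (hbound u) _
    _ = ENNReal.ofReal (n * 4 ^ 2) := by
        rw [lintegral_mul_const' _ _ ENNReal.ofReal_ne_top,
          lintegral_pi_prod fun _ => measurable_obsWeight h₁]
        simp [hw]

/-- The mean gap between the relay's input and output. -/
def meanGap (h₁ h₂ : ℝ) {n : ℕ} (ω : Primitive n × Seq n) : ℝ :=
  (∑ l, gap h₁ h₂ (seqU h₁ ω l) (seqV ω l)) / n

lemma statistic_sub_meanGap {h₁ h₂ h₃ : ℝ} (hh₃ : h₃ ≠ 0) {n : ℕ} (ω : Primitive n × Seq n) :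
    statistic h₁ h₂ h₃ n (seqX h₃ ω) (seqY h₂ ω) - meanGap h₁ h₂ ω =
      -(h₁ * h₂) * ((∑ l, noiseY h₁ h₂ ω l) / n - (∑ l, noiseX h₁ h₂ h₃ ω l) / n -
        (∑ l, noiseS h₁ h₂ ω l) / n + ((∑ l, regr h₁ h₂ (seqU h₁ ω l) (seqU h₁ ω l)) / n -
        ∫ u, regr h₁ h₂ u u ∂(obsLaw h₁))) := by
  rw [statistic, meanGap]
  simp only [testFn_eq hh₃, gap, ← Finset.mul_sum, Finset.sum_sub_distrib, Finset.sum_add_distrib]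
  ring

/-- Whatever the attack, the decision statistic is asymptotically the mean gap. -/
lemma tendsto_statistic_sub_meanGap {h₁ h₂ h₃ : ℝ} (hh₁ : h₁ ≠ 0) (hh₂ : h₂ ≠ 0) (hh₃ : h₃ ≠ 0)
    (K : ∀ n : ℕ, Kernel (Seq n) (Seq n)) [∀ n, IsMarkovKernel (K n)] {r : ℝ} (hr : 0 < r) :
    Tendsto (fun n => networkLaw h₁ (K n)
      {ω | r ≤ |statistic h₁ h₂ h₃ n (seqX h₃ ω) (seqY h₂ ω) - meanGap h₁ h₂ ω|})
      atTop (𝓝 0) := by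
  have hA : 0 < |h₁ * h₂| := abs_pos.2 (mul_ne_zero hh₁ hh₂)
  -- Four error averages, all multiplied by $h_1h_2$, share the tolerance $r$.
  set r' := r / |h₁ * h₂| / 4 with hr'
  have hr'0 : 0 < r' := by positivity
  have t1 := tendsto_of_second_moment (fun n => networkLaw h₁ (K n))
    (fun n ω => ∑ l, noiseY h₁ h₂ ω l) (fun n => by unfold noiseY; fun_prop) (4 ^ 2)
    (fun n => lintegral_noiseY_le h₁ h₂ (K n)) hr'0
  have t2 := tendsto_of_second_moment (fun n => networkLaw h₁ (K n))
    (fun n ω => ∑ l, noiseX h₁ h₂ h₃ ω l) (fun n => by unfold noiseX; fun_prop) ((2 / |h₃|) ^ 2)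
    (fun n => lintegral_noiseX_le h₁ h₂ h₃ (K n)) hr'0
  have t3 := tendsto_of_second_moment (fun n => networkLaw h₁ (K n))
    (fun n ω => ∑ l, noiseS h₁ h₂ ω l) (fun n => by unfold noiseS; fun_prop) (4 ^ 2)
    (fun n => lintegral_noiseS_le h₁ h₂ (K n)) hr'0
  have hreg : Measurable fun u => regr h₁ h₂ u u := by unfold regr; fun_prop
  have t4 := tendsto_mean_seqU h₁ K hreg (fun u => abs_regr_le h₁ h₂ u u) hr'0
  have t := ((t1.add t2).add t3).add t4
  simp only [add_zero] at t
  refine tendsto_of_tendsto_of_tendsto_of_le_of_le tendsto_const_nhds t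
    (fun n => zero_le) fun n => ?_
  refine le_trans (measure_mono ?_) ((measure_union_le _ _).trans (add_le_add_left
    ((measure_union_le _ _).trans (add_le_add_left (measure_union_le _ _) _)) _))
  intro ω hω
  simp only [Set.mem_union, Set.mem_ofPred_eq] at hω ⊢
  by_contra hcon
  push Not at hcon
  obtain ⟨⟨⟨c1, c2⟩, c3⟩, c4⟩ := hcon
  rw [statistic_sub_meanGap hh₃, abs_mul, abs_neg] at hω
  have h4 : r = |h₁ * h₂| * (4 * r') := by rw [hr']; field_simp
  rw [h4] at hω
  have := le_of_mul_le_mul_left hω hA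
  rw [abs_lt] at c1 c2 c3 c4
  rcases le_abs.1 this with h | h <;> linarith [c1.1, c1.2, c2.1, c2.2, c3.1, c3.2, c4.1, c4.2]

/-! ### Quantizer cells -/

lemma measurableSet_cell (α β : ℝ) (N : ℕ) (j : Fin N) : MeasurableSet (cell α β N j) := by
  unfold cell
  split_ifs
  · exact measurableSet_Iic
  · exact measurableSet_Ioi
  · exact measurableSet_Ioc

lemma convex_cell (α β : ℝ) (N : ℕ) (j : Fin N) : Convex ℝ (cell α β N j) := by
  unfold cell
  split_ifs
  · exact convex_Iic _
  · exact convex_Ioi _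
  · exact convex_Ioc _ _

lemma nonempty_compl_cell (α β : ℝ) (N : ℕ) (j : Fin N) : (cell α β N j)ᶜ.Nonempty := by
  unfold cell
  split_ifs
  · exact ⟨α + 1, by simp⟩
  · exact ⟨β, by simp⟩
  · exact ⟨_, fun h => lt_irrefl _ (Set.mem_Ioc.1 h).1⟩

lemma step_pos {α β : ℝ} {N : ℕ} (h : α < β) (hN : 3 ≤ N) : 0 < step α β N := by
  have : (3 : ℝ) ≤ N := by exact_mod_cast hN
  exact div_pos (by linarith) (by linarith)

lemma volume_cell_pos {α β : ℝ} {N : ℕ} (h : α < β) (hN : 3 ≤ N) (j : Fin N) :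
    0 < volume (cell α β N j) := by
  have hs := step_pos h hN
  unfold cell
  split_ifs
  · simp
  · simp
  · rw [Real.volume_Ioc, ENNReal.ofReal_pos]
    linarith

lemma exists_mem_cell {α β : ℝ} {N : ℕ} (h : α < β) (hN : 3 ≤ N) (x : ℝ) :
    ∃ j, x ∈ cell α β N j := by
  have hs := step_pos h hN
  have hN' : (3 : ℝ) ≤ N := by exact_mod_cast hN
  have hβ : β - α = ((N : ℝ) - 2) * step α β N := by
    rw [step]
    field_simp [show (N : ℝ) - 2 ≠ 0 by linarith]
  by_cases h1 : x ≤ α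
  · exact ⟨⟨0, by omega⟩, by simpa [cell] using h1⟩
  by_cases h2 : β < x
  · refine ⟨⟨N - 1, by omega⟩, ?_⟩
    simp only [cell]
    rw [if_neg (by omega), if_pos (by omega)]
    exact h2
  push Not at h1 h2
  -- The bounded cells are closed on the right and numbered from $1$, so the ceiling gives the
  -- index.
  set k := ⌈(x - α) / step α β N⌉₊ with hk
  have hk0 : 0 < k := Nat.ceil_pos.2 (div_pos (by linarith) hs)
  have hkN : k ≤ N - 2 := by
    apply Nat.ceil_le.2
    rw [Nat.cast_sub (by omega), div_le_iff₀ hs]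
    push_cast
    linarith
  have h3 : (x - α) / step α β N ≤ k := Nat.le_ceil _
  have h4 : (k : ℝ) < (x - α) / step α β N + 1 :=
    Nat.ceil_lt_add_one (div_pos (by linarith) hs).le
  refine ⟨⟨k, by omega⟩, ?_⟩
  simp only [cell]
  rw [if_neg (by omega), if_neg (by omega), Set.mem_Ioc]
  rw [div_le_iff₀ hs] at h3
  rw [← sub_lt_iff_lt_add, lt_div_iff₀ hs] at h4
  constructor <;> linarith

/-- Two points of one cell are close, unless the cell is unbounded. -/
lemma abs_sub_le_step_of_mem_cell {α β : ℝ} {N : ℕ} {j : Fin N} {x y : ℝ}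
    (hx : x ∈ cell α β N j) (hy : y ∈ cell α β N j) (ht : x ∉ Set.Iic α ∪ Set.Ioi β) :
    |y - x| ≤ step α β N := by
  unfold cell at hx hy
  split_ifs at hx hy
  · exact absurd (Or.inl hx) ht
  · exact absurd (Or.inr hx) ht
  · rw [abs_le]
    obtain ⟨x1, x2⟩ := hx
    obtain ⟨y1, y2⟩ := hy
    constructor <;> linarith

/-! ### The empirical kernel -/

namespace QuantScheme

/-- The level `n'` is large enough for the quantizers to be nondegenerate and nested. -/
structure Regular (Q : QuantScheme) (n' : ℕ) : Prop where
  three_le : 3 ≤ n'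
  three_le_nv : 3 ≤ Q.nv n'
  lt₁ : Q.α₁ n' < Q.β₁ n'
  lt₂ : Q.α₂ n' < Q.β₂ n'
  nested : ∀ (i : Fin n') (j : Fin (Q.nv n')),
    Q.cellU n' i ⊆ Q.cellV n' j ∨ Disjoint (Q.cellU n' i) (Q.cellV n' j)

lemma eventually_regular (Q : QuantScheme) : ∀ᶠ n' in atTop, Q.Regular n' := by
  filter_upwards [eventually_ge_atTop 3, Q.tendsto_nv.eventually_ge_atTop 3, Q.lt₁, Q.lt₂,
    Q.nested] with n' h1 h2 h3 h4 h5
  exact ⟨h1, h2, h3, h4, h5⟩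

lemma measurableSet_cellU (Q : QuantScheme) (n' : ℕ) (i : Fin n') :
    MeasurableSet (Q.cellU n' i) := measurableSet_cell _ _ _ _

lemma measurableSet_cellV (Q : QuantScheme) (n' : ℕ) (j : Fin (Q.nv n')) :
    MeasurableSet (Q.cellV n' j) := measurableSet_cell _ _ _ _

variable {Q : QuantScheme} {n' : ℕ}

lemma Regular.nonempty_cellU (hQ : Q.Regular n') (i : Fin n') : (Q.cellU n' i).Nonempty :=
  nonempty_of_measure_ne_zero (volume_cell_pos hQ.lt₁ hQ.three_le i).ne'

lemma Regular.exists_subset (hQ : Q.Regular n') (i : Fin n') :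
    ∃ j, Q.cellU n' i ⊆ Q.cellV n' j := by
  obtain ⟨x, hx⟩ := hQ.nonempty_cellU i
  obtain ⟨j, hj⟩ := exists_mem_cell hQ.lt₂ hQ.three_le_nv x
  exact ⟨j, (hQ.nested i j).resolve_right fun hd => Set.disjoint_left.1 hd hx hj⟩

lemma Regular.obsLaw_cellU_pos (hQ : Q.Regular n') (h₁ : ℝ) (i : Fin n') :
    0 < (obsLaw h₁).real (Q.cellU n' i) := by
  rw [measureReal_def, ENNReal.toReal_pos_iff]
  refine ⟨pos_iff_ne_zero.2 fun h => ?_, measure_lt_top _ _⟩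
  exact (volume_cell_pos hQ.lt₁ hQ.three_le i).ne' (absolutelyContinuous_obsLaw h₁ h)

end QuantScheme

/-- Number of positions at which the input is in `B` and the output is not. -/
def exitCount {n : ℕ} (B : Set ℝ) (u v : Seq n) : ℝ :=
  ∑ l, B.indicator (fun _ => (1 : ℝ)) (u l) * Bᶜ.indicator (fun _ => (1 : ℝ)) (v l)

lemma ind_nonneg (B : Set ℝ) (x : ℝ) : 0 ≤ B.indicator (fun _ => (1 : ℝ)) x :=
  Set.indicator_nonneg (by simp) _

lemma ind_le_one (B : Set ℝ) (x : ℝ) : B.indicator (fun _ => (1 : ℝ)) x ≤ 1 :=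
  Set.indicator_le_self' (fun _ _ => zero_le_one) _

lemma count_nonneg {n : ℕ} (B : Set ℝ) (u : Seq n) : 0 ≤ count B u :=
  Finset.sum_nonneg fun _ _ => ind_nonneg _ _

lemma count_le {n : ℕ} (B : Set ℝ) (u : Seq n) : count B u ≤ n :=
  (Finset.sum_le_sum fun l _ => ind_le_one B (u l)).trans (by simp)

lemma measurable_count {n : ℕ} {B : Set ℝ} (hB : MeasurableSet B) :
    Measurable (count B : Seq n → ℝ) :=
  Finset.measurable_sum _ fun l _ => (measurable_const.indicator hB).comp (measurable_pi_apply l)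

lemma measurable_deviation (Q : QuantScheme) (n' n : ℕ) :
    Measurable fun p : Seq n × Seq n => deviation Q n' p.1 p.2 := by
  unfold deviation
  refine Finset.measurable_sum _ fun j _ => Finset.measurable_sum _ fun i _ => ?_
  refine Measurable.abs (Measurable.sub_const ?_ _)
  have hc : Measurable fun p : Seq n × Seq n => count (Q.cellU n' i) p.1 :=
    (measurable_count (Q.measurableSet_cellU n' i)).comp measurable_fst
  unfold empKernel
  refine Measurable.ite (hc (measurableSet_singleton 0)) measurable_const (Measurable.div ?_ hc)
  refine Finset.measurable_sum _ fun l _ => Measurable.mul ?_ ?_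
  · exact (measurable_const.indicator (Q.measurableSet_cellV n' j)).comp
      ((measurable_pi_apply l).comp measurable_snd)
  · exact (measurable_const.indicator (Q.measurableSet_cellU n' i)).comp
      ((measurable_pi_apply l).comp measurable_fst)

lemma measurable_R (Q : QuantScheme) (h₁ : ℝ) (n' n : ℕ) :
    Measurable (R Q h₁ n' : Primitive n × Seq n → ℝ) :=
  (measurable_deviation Q n' n).comp (f := fun ω => (seqU h₁ ω, seqV ω)) (by fun_prop)

/-- An entry of the empirical kernel deviates from the identity by at most the exit frequency. -/
lemma abs_empKernel_sub_le {Q : QuantScheme} {n' : ℕ} (hQ : Q.Regular n') {n : ℕ} (u v : Seq n)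
    (i : Fin n') (j : Fin (Q.nv n')) (hc : count (Q.cellU n' i) u ≠ 0) :
    |empKernel Q n' u v i j - idKernel Q n' i j| * count (Q.cellU n' i) u ≤
      exitCount (Q.cellU n' i) u v := by
  have hc0 : 0 < count (Q.cellU n' i) u := lt_of_le_of_ne (count_nonneg _ _) hc.symm
  rw [empKernel, if_neg hc, idKernel]
  set T := ∑ l, (Q.cellV n' j).indicator (fun _ => (1 : ℝ)) (v l) *
    (Q.cellU n' i).indicator (fun _ => (1 : ℝ)) (u l) with hT
  split_ifs with hsub
  · have e : T / count (Q.cellU n' i) u - 1 = -((count (Q.cellU n' i) u - T) /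
        count (Q.cellU n' i) u) := by field_simp; ring
    have hdiff : count (Q.cellU n' i) u - T = ∑ l, (1 - (Q.cellV n' j).indicator
        (fun _ => (1 : ℝ)) (v l)) * (Q.cellU n' i).indicator (fun _ => (1 : ℝ)) (u l) := by
      rw [count, hT, ← Finset.sum_sub_distrib]
      exact Finset.sum_congr rfl fun l _ => by ring
    have h0 : 0 ≤ count (Q.cellU n' i) u - T := by
      rw [hdiff]
      exact Finset.sum_nonneg fun l _ => mul_nonneg (sub_nonneg.2 (ind_le_one _ _)) (ind_nonneg _ _)
    rw [e, abs_neg, abs_of_nonneg (div_nonneg h0 hc0.le), div_mul_cancel₀ _ hc, hdiff]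
    refine Finset.sum_le_sum fun l _ => ?_
    rw [mul_comm]
    refine mul_le_mul_of_nonneg_left ?_ (ind_nonneg _ _)
    by_cases hv : v l ∈ Q.cellV n' j
    · rw [Set.indicator_of_mem hv, sub_self]
      exact ind_nonneg _ _
    · rw [Set.indicator_of_notMem hv, Set.indicator_of_mem
        (show v l ∈ (Q.cellU n' i)ᶜ from fun h => hv (hsub h)), sub_zero]
  · have hd := (hQ.nested i j).resolve_left hsub
    have hT0 : 0 ≤ T := Finset.sum_nonneg fun l _ => mul_nonneg (ind_nonneg _ _) (ind_nonneg _ _)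
    rw [sub_zero, abs_of_nonneg (div_nonneg hT0 hc0.le), div_mul_cancel₀ _ hc]
    refine Finset.sum_le_sum fun l _ => ?_
    rw [mul_comm]
    refine mul_le_mul_of_nonneg_left ?_ (ind_nonneg _ _)
    by_cases hv : v l ∈ Q.cellV n' j
    · rw [Set.indicator_of_mem hv,
        Set.indicator_of_mem (show v l ∈ (Q.cellU n' i)ᶜ from Set.disjoint_right.1 hd hv)]
    · rw [Set.indicator_of_notMem hv]
      exact ind_nonneg _ _

/-- A large deviation forces many exits from some input cell. -/
lemma exists_exitCount_ge {Q : QuantScheme} {n' : ℕ} (hQ : Q.Regular n') {n : ℕ} {u v : Seq n}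
    {δ : ℝ} (hdev : δ < deviation Q n' u v) (hc : ∀ i, count (Q.cellU n' i) u ≠ 0) :
    ∃ i, δ / (Q.nv n' * n') * count (Q.cellU n' i) u ≤ exitCount (Q.cellU n' i) u v := by
  by_contra hcon
  push Not at hcon
  have hpos : (0 : ℝ) < Q.nv n' * n' := by
    have h1 := hQ.three_le
    have h2 := hQ.three_le_nv
    positivity
  have hle : deviation Q n' u v ≤ ∑ _j : Fin (Q.nv n'), ∑ _i : Fin n', δ / (Q.nv n' * n') := by
    refine Finset.sum_le_sum fun j _ => Finset.sum_le_sum fun i _ => ?_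
    have hc0 : 0 < count (Q.cellU n' i) u := lt_of_le_of_ne (count_nonneg _ _) (hc i).symm
    exact le_of_mul_le_mul_right
      ((abs_empKernel_sub_le hQ u v i j (hc i)).trans (hcon i).le) hc0
  have : ∑ _j : Fin (Q.nv n'), ∑ _i : Fin n', δ / (Q.nv n' * n') = δ := by
    simp only [Finset.sum_const, Finset.card_univ, Fintype.card_fin, nsmul_eq_mul]
    rw [← mul_assoc, mul_div_cancel₀ _ hpos.ne']
  linarith

/-- A small deviation keeps most outputs in the output cell of their input. -/
lemma sum_not_mem_cellV_le {Q : QuantScheme} {n' : ℕ} {n : ℕ} (u v : Seq n)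
    {J : Fin n' → Fin (Q.nv n')} (hJ : ∀ i, Q.cellU n' i ⊆ Q.cellV n' (J i)) :
    ∑ l, ∑ i, (Q.cellU n' i).indicator (fun _ => (1 : ℝ)) (u l) *
      (1 - (Q.cellV n' (J i)).indicator (fun _ => (1 : ℝ)) (v l)) ≤ n * deviation Q n' u v := by
  rw [Finset.sum_comm]
  have hle : ∀ i, ∑ l, (Q.cellU n' i).indicator (fun _ => (1 : ℝ)) (u l) *
      (1 - (Q.cellV n' (J i)).indicator (fun _ => (1 : ℝ)) (v l)) ≤
      n * |empKernel Q n' u v i (J i) - idKernel Q n' i (J i)| := by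
    intro i
    have hn : (0 : ℝ) ≤ n := Nat.cast_nonneg n
    -- For an unvisited cell the left side vanishes, so the default value of `empKernel` is
    -- harmless.
    by_cases hc : count (Q.cellU n' i) u = 0
    · have h0 : ∑ l, (Q.cellU n' i).indicator (fun _ => (1 : ℝ)) (u l) *
          (1 - (Q.cellV n' (J i)).indicator (fun _ => (1 : ℝ)) (v l)) ≤
          count (Q.cellU n' i) u :=
        Finset.sum_le_sum fun l _ => mul_le_of_le_one_right (ind_nonneg _ _)
          (by linarith [ind_nonneg (Q.cellV n' (J i)) (v l)])
      rw [hc] at h0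
      exact h0.trans (by positivity)
    · have hc0 : 0 < count (Q.cellU n' i) u := lt_of_le_of_ne (count_nonneg _ _) (Ne.symm hc)
      rw [empKernel, if_neg hc, idKernel, if_pos (hJ i)]
      set T := ∑ l, (Q.cellV n' (J i)).indicator (fun _ => (1 : ℝ)) (v l) *
        (Q.cellU n' i).indicator (fun _ => (1 : ℝ)) (u l) with hT
      have e : ∑ l, (Q.cellU n' i).indicator (fun _ => (1 : ℝ)) (u l) *
          (1 - (Q.cellV n' (J i)).indicator (fun _ => (1 : ℝ)) (v l)) =
          count (Q.cellU n' i) u * -(T / count (Q.cellU n' i) u - 1) := by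
        have : count (Q.cellU n' i) u * -(T / count (Q.cellU n' i) u - 1) =
            count (Q.cellU n' i) u - T := by field_simp; ring
        rw [this, count, hT, ← Finset.sum_sub_distrib]
        exact Finset.sum_congr rfl fun l _ => by ring
      rw [e]
      exact mul_le_mul (count_le _ _) (neg_le_abs _)
        (by rw [← mul_le_mul_iff_right₀ hc0, mul_zero, ← e]
            exact Finset.sum_nonneg fun l _ => mul_nonneg (ind_nonneg _ _)
              (sub_nonneg.2 (ind_le_one _ _))) hn
  calc _ ≤ ∑ i, n * |empKernel Q n' u v i (J i) - idKernel Q n' i (J i)| :=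
        Finset.sum_le_sum fun i _ => hle i
    _ = n * ∑ i, |empKernel Q n' u v i (J i) - idKernel Q n' i (J i)| := by rw [Finset.mul_sum]
    _ ≤ n * deviation Q n' u v := by
        refine mul_le_mul_of_nonneg_left ?_ (Nat.cast_nonneg n)
        rw [deviation, Finset.sum_comm]
        exact Finset.sum_le_sum fun i _ => Finset.single_le_sum
          (f := fun j => |empKernel Q n' u v i j - idKernel Q n' i j|)
          (fun j _ => abs_nonneg _) (Finset.mem_univ (J i))

/-- The mean gap is small when the deviation is. -/
lemma meanGap_le {h₁ h₂ : ℝ} {Q : QuantScheme} {n' : ℕ} (hQ : Q.Regular n') {n : ℕ} (hn : 0 < n)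
    (ω : Primitive n × Seq n) :
    meanGap h₁ h₂ ω ≤ 4 * |h₁ * h₂| * R Q h₁ n' ω +
      4 * |h₁ * h₂| * (|h₂| * step (Q.α₂ n') (Q.β₂ n') (Q.nv n')) +
      4 * |h₁ * h₂| *
        (count (Set.Iic (Q.α₂ n') ∪ Set.Ioi (Q.β₂ n')) (seqU h₁ ω) / n) := by
  have hn' : (0 : ℝ) < n := Nat.cast_pos.2 hn
  choose J hJ using hQ.exists_subset
  have hbad := sum_not_mem_cellV_le (seqU h₁ ω) (seqV ω) hJ
  set u := seqU h₁ ω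
  set v := seqV ω
  set A := 4 * |h₁ * h₂| with hA
  have hA0 : 0 ≤ A := by positivity
  set σ := step (Q.α₂ n') (Q.β₂ n') (Q.nv n') with hσ
  have hσ0 : 0 < σ := step_pos hQ.lt₂ hQ.three_le_nv
  set tail := Set.Iic (Q.α₂ n') ∪ Set.Ioi (Q.β₂ n') with htail
  have hl : ∀ l, gap h₁ h₂ (u l) (v l) ≤
      A * ∑ i, (Q.cellU n' i).indicator (fun _ => (1 : ℝ)) (u l) *
        (1 - (Q.cellV n' (J i)).indicator (fun _ => (1 : ℝ)) (v l)) +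
      A * (|h₂| * σ) + A * tail.indicator (fun _ => (1 : ℝ)) (u l) := by
    intro l
    have hterm : ∀ i, 0 ≤ (Q.cellU n' i).indicator (fun _ => (1 : ℝ)) (u l) *
        (1 - (Q.cellV n' (J i)).indicator (fun _ => (1 : ℝ)) (v l)) := fun i =>
      mul_nonneg (ind_nonneg _ _) (sub_nonneg.2 (ind_le_one _ _))
    have hsum0 := Finset.sum_nonneg fun i (_ : i ∈ Finset.univ) => hterm i
    have h2 : 0 ≤ A * (|h₂| * σ) := by positivity
    have h3 := mul_nonneg hA0 (ind_nonneg tail (u l))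
    -- Each position is charged to one of three terms: inputs in the unbounded output cells, outputs
    -- in the bounded output cell of their input (gap controlled by the mesh), and outputs that left
    -- it.
    by_cases ht : u l ∈ tail
    · rw [Set.indicator_of_mem ht]
      have := gap_le_const h₁ h₂ (u l) (v l)
      have := mul_nonneg hA0 hsum0
      linarith
    obtain ⟨i, hi⟩ := exists_mem_cell hQ.lt₁ hQ.three_le (u l)
    by_cases hv : v l ∈ Q.cellV n' (J i)
    · have hd := abs_sub_le_step_of_mem_cell (hJ i hi) hv ht
      have h4 := gap_le_dist h₁ h₂ (u l) (v l)
      have h5 : A * (|h₂| * |v l - u l|) ≤ A * (|h₂| * σ) := by gcongr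
      have := mul_nonneg hA0 hsum0
      linarith
    · have h1 : 1 ≤ ∑ i, (Q.cellU n' i).indicator (fun _ => (1 : ℝ)) (u l) *
          (1 - (Q.cellV n' (J i)).indicator (fun _ => (1 : ℝ)) (v l)) := by
        refine le_trans ?_ (Finset.single_le_sum (fun i _ => hterm i) (Finset.mem_univ i))
        rw [Set.indicator_of_mem (show u l ∈ Q.cellU n' i from hi), Set.indicator_of_notMem hv]
        simp
      have := gap_le_const h₁ h₂ (u l) (v l)
      have := mul_le_mul_of_nonneg_left h1 hA0
      linarith
  have hsum : ∑ l, gap h₁ h₂ (u l) (v l) ≤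
      A * (n * deviation Q n' u v) + n * (A * (|h₂| * σ)) + A * count tail u := by
    refine (Finset.sum_le_sum fun l _ => hl l).trans ?_
    simp only [Finset.sum_add_distrib, ← Finset.mul_sum, Finset.sum_const, Finset.card_univ, Fintype.card_fin, nsmul_eq_mul]
    have := mul_le_mul_of_nonneg_left hbad hA0
    rw [count]
    linarith
  rw [meanGap, div_le_iff₀ hn']
  refine hsum.trans (le_of_eq ?_)
  rw [R]
  field_simp
  ring

/-- Lower bound for the gap at an input `u` in `B` and any output outside `B`. -/
def exitGap (h₁ h₂ : ℝ) (B : Set ℝ) (u : ℝ) : ℝ :=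
  min (gap h₁ h₂ u (u + Metric.infDist u Bᶜ)) (gap h₁ h₂ u (u - Metric.infDist u Bᶜ))

lemma measurable_exitGap (h₁ h₂ : ℝ) (B : Set ℝ) : Measurable (exitGap h₁ h₂ B) := by
  have hd : Continuous fun u => Metric.infDist u Bᶜ := Metric.continuous_infDist_pt _
  refine (Continuous.min ?_ ?_).measurable
  · exact (continuous_gap h₁ h₂).comp (f := fun u => (u, u + Metric.infDist u Bᶜ)) (by fun_prop)
  · exact (continuous_gap h₁ h₂).comp (f := fun u => (u, u - Metric.infDist u Bᶜ)) (by fun_prop)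

/-- An output outside $B$ is at least as far from $u$ as $B^c$ is, so an exit costs at least
`exitGap`. Inputs at which this cost is below $t$ are paid for by the last term. -/
lemma mul_exitCount_le {h₁ h₂ : ℝ} (hh₁ : h₁ ≠ 0) (hh₂ : h₂ ≠ 0) {t : ℝ} (ht : 0 ≤ t)
    (B : Set ℝ) {n : ℕ} (ω : Primitive n × Seq n) :
    t * exitCount B (seqU h₁ ω) (seqV ω) ≤
      ∑ l, gap h₁ h₂ (seqU h₁ ω l) (seqV ω l) +
        t * count {u | u ∈ B ∧ exitGap h₁ h₂ B u < t} (seqU h₁ ω) := by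
  rw [exitCount, count, Finset.mul_sum, Finset.mul_sum, ← Finset.sum_add_distrib]
  refine Finset.sum_le_sum fun l _ => ?_
  have hg := gap_nonneg hh₁ hh₂ (seqU h₁ ω l) (seqV ω l)
  set u := seqU h₁ ω l
  set v := seqV ω l
  have hi := mul_nonneg ht (ind_nonneg {u | u ∈ B ∧ exitGap h₁ h₂ B u < t} u)
  by_cases hu : u ∈ B
  · by_cases hv : v ∈ B
    · rw [Set.indicator_of_notMem (s := Bᶜ) (by simpa using hv)]
      linarith
    rw [Set.indicator_of_mem hu, Set.indicator_of_mem (s := Bᶜ) hv]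
    by_cases hk : exitGap h₁ h₂ B u < t
    · rw [Set.indicator_of_mem (show u ∈ {u | u ∈ B ∧ exitGap h₁ h₂ B u < t} from ⟨hu, hk⟩)]
      linarith
    · push Not at hk
      have hd : Metric.infDist u Bᶜ ≤ |u - v| := Metric.infDist_le_dist_of_mem hv
      have := min_gap_le hh₁ hh₂ Metric.infDist_nonneg hd
      rw [exitGap] at hk
      linarith
  · rw [Set.indicator_of_notMem hu]
    linarith

/-- Few inputs of a cell are close enough to its boundary for their exit gap to be small. -/
lemma exists_exitGap_small {h₁ h₂ : ℝ} (hh₁ : h₁ ≠ 0) (hh₂ : h₂ ≠ 0) {B : Set ℝ}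
    (hB : MeasurableSet B) (hconv : Convex ℝ B) (hne : Bᶜ.Nonempty) {γ : ℝ} (hγ : 0 < γ) :
    ∃ t > 0, (obsLaw h₁).real {u | u ∈ B ∧ exitGap h₁ h₂ B u < t} < γ := by
  set A : ℕ → Set ℝ := fun m => {u | u ∈ B ∧ exitGap h₁ h₂ B u < 1 / ((m : ℝ) + 1)} with hA
  have hAm : ∀ m, MeasurableSet (A m) := fun m =>
    hB.inter (measurableSet_lt (measurable_exitGap h₁ h₂ B) measurable_const)
  have hanti : Antitone A := fun m k hmk u hu => by
    refine ⟨hu.1, hu.2.trans_le ?_⟩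
    exact Nat.one_div_le_one_div hmk
  -- An interior point of $B$ has positive distance to $B^c$, hence a positive exit gap.
  have hinter : ⋂ m, A m ⊆ frontier B := by
    intro u hu
    rw [Set.mem_iInter] at hu
    have hle : exitGap h₁ h₂ B u ≤ 0 := by
      by_contra hpos
      push Not at hpos
      obtain ⟨m, hm⟩ := exists_nat_one_div_lt hpos
      exact lt_asymm hm (hu m).2
    by_contra hf
    have hint : u ∈ interior B := by
      by_contra hni
      exact hf ⟨subset_closure (hu 0).1, hni⟩
    have hd : 0 < Metric.infDist u Bᶜ := by
      rw [← Metric.infDist_pos_iff_notMem_closure hne, closure_compl]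
      exact fun h => h hint
    exact absurd hle (not_le.2 (lt_min (gap_pos hh₁ hh₂ (by linarith))
      (gap_pos hh₁ hh₂ (by linarith))))
  -- The frontier of a convex set is Lebesgue null.
  have hzero : obsLaw h₁ (⋂ m, A m) = 0 :=
    measure_mono_null hinter (obsLaw_absolutelyContinuous h₁ (hconv.addHaar_frontier volume))
  have hlim := tendsto_measure_iInter_atTop (μ := obsLaw h₁)
    (fun m => (hAm m).nullMeasurableSet) hanti ⟨0, measure_ne_top _ _⟩
  rw [hzero] at hlim
  obtain ⟨m, hm⟩ := (hlim.eventually_lt_const (ENNReal.ofReal_pos.2 hγ)).exists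
  refine ⟨1 / ((m : ℝ) + 1), by positivity, ?_⟩
  rw [measureReal_def]
  exact (ENNReal.lt_ofReal_iff_toReal_lt (measure_ne_top _ _)).1 hm

/-! ### Conditional probabilities -/

/-- Amounts to dividing by a probability bounded away from $0$. The set `A'` is kept apart from `A`
because, for false alarms, the lower bound concerns $R<\delta$ while the conditioning is on
$R\le\delta$. -/
lemma tendsto_cond_zero {Ω : ℕ → Type*} [∀ n, MeasurableSpace (Ω n)] (μ : ∀ n, Measure (Ω n))
    [∀ n, IsProbabilityMeasure (μ n)] {A A' T : ∀ n, Set (Ω n)}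
    (hA : ∀ n, MeasurableSet (A n)) (hsub : ∀ n, A' n ⊆ A n)
    (hpos : 0 < liminf (fun n => μ n (A' n)) atTop)
    (h0 : Tendsto (fun n => μ n (A n ∩ T n)) atTop (𝓝 0)) :
    Tendsto (fun n => (ProbabilityTheory.cond (μ n) (A n)).real (T n)) atTop (𝓝 0) := by
  obtain ⟨c, hc0, hc⟩ := exists_between hpos
  have hev := eventually_lt_of_lt_liminf hc
  have hlim : Tendsto (fun n => c⁻¹ * μ n (A n ∩ T n)) atTop (𝓝 0) := by
    have := ENNReal.Tendsto.const_mul h0 (Or.inr (ENNReal.inv_ne_top.2 hc0.ne'))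
    rwa [mul_zero] at this
  have hcond : Tendsto (fun n => ProbabilityTheory.cond (μ n) (A n) (T n)) atTop (𝓝 0) := by
    refine tendsto_of_tendsto_of_tendsto_of_le_of_le' tendsto_const_nhds hlim
      (Eventually.of_forall fun n => zero_le) ?_
    filter_upwards [hev] with n hn
    rw [cond_apply (hA n)]
    gcongr
    exact hn.le.trans (measure_mono (hsub n))
  have := (ENNReal.tendsto_toReal ENNReal.zero_ne_top).comp hcond
  rwa [ENNReal.toReal_zero] at this

lemma tendsto_cond_one {Ω : ℕ → Type*} [∀ n, MeasurableSpace (Ω n)] (μ : ∀ n, Measure (Ω n))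
    [∀ n, IsProbabilityMeasure (μ n)] {A T : ∀ n, Set (Ω n)}
    (hA : ∀ n, MeasurableSet (A n)) (hT : ∀ n, MeasurableSet (T n))
    (hpos : 0 < liminf (fun n => μ n (A n)) atTop)
    (h0 : Tendsto (fun n => μ n (A n ∩ (T n)ᶜ)) atTop (𝓝 0)) :
    Tendsto (fun n => (ProbabilityTheory.cond (μ n) (A n)).real (T n)) atTop (𝓝 1) := by
  have hz := (tendsto_cond_zero μ hA (fun n => subset_rfl) hpos h0).const_sub 1
  rw [sub_zero] at hz
  refine hz.congr' ?_
  filter_upwards [eventually_lt_of_lt_liminf hpos] with n hn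
  have := cond_isProbabilityMeasure (μ := μ n) (s := A n) hn.ne'
  rw [probReal_compl_eq_one_sub (hT n), sub_sub_cancel]

/-! ### Detection -/

section Detection

variable {h₁ h₂ h₃ : ℝ} {Q : QuantScheme} {n' : ℕ}

lemma tendsto_count {B : Set ℝ} (hB : MeasurableSet B) (K : ∀ n : ℕ, Kernel (Seq n) (Seq n))
    [∀ n, IsMarkovKernel (K n)] {r : ℝ} (hr : 0 < r) :
    Tendsto (fun n => networkLaw h₁ (K n)
      {ω | r ≤ |count B (seqU h₁ ω) / n - (obsLaw h₁).real B|}) atTop (𝓝 0) := by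
  have h := tendsto_mean_seqU h₁ K (f := B.indicator fun _ => (1 : ℝ))
    (measurable_const.indicator hB) (M := 1)
    (fun u => by rw [abs_of_nonneg (ind_nonneg _ _)]; exact ind_le_one _ _) hr
  rwa [show ∫ u, B.indicator (fun _ => (1 : ℝ)) u ∂(obsLaw h₁) = (obsLaw h₁).real B from
    integral_indicator_one hB] at h

/-- Union bound over a finite family of asymptotically negligible events. -/
lemma tendsto_measure_iUnion_zero {Ω : ℕ → Type*} [∀ n, MeasurableSpace (Ω n)]
    (μ : ∀ n, Measure (Ω n)) {ι : Type*} [Fintype ι] (A : ι → ∀ n, Set (Ω n))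
    (h : ∀ i, Tendsto (fun n => μ n (A i n)) atTop (𝓝 0)) :
    Tendsto (fun n => μ n (⋃ i, A i n)) atTop (𝓝 0) := by
  have hs := tendsto_finsetSum Finset.univ fun i (_ : i ∈ Finset.univ) => h i
  rw [Finset.sum_const_zero] at hs
  exact tendsto_of_tendsto_of_tendsto_of_le_of_le tendsto_const_nhds hs (fun n => zero_le)
    fun n => measure_iUnion_fintype_le _ _

/-- The threshold: deviations above `δ` push the statistic above it. -/
lemma exists_threshold (hh₁ : h₁ ≠ 0) (hh₂ : h₂ ≠ 0) (hh₃ : h₃ ≠ 0) (hQ : Q.Regular n')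
    {δ η : ℝ} (hδ : 0 < δ) (hη : 0 < η) :
    ∃ τ, (0 < τ ∧ τ < η) ∧ ∀ K : ∀ n : ℕ, Kernel (Seq n) (Seq n), (∀ n, IsMarkovKernel (K n)) →
      Tendsto (fun n => networkLaw h₁ (K n) ({ω | δ < R Q h₁ n' ω} ∩
        {ω | τ < statistic h₁ h₂ h₃ n (seqX h₃ ω) (seqY h₂ ω)}ᶜ)) atTop (𝓝 0) := by
  have hN : (0 : ℝ) < Q.nv n' * n' := by
    have h1 := hQ.three_le
    have h2 := hQ.three_le_nv
    positivity
  set p : Fin n' → ℝ := fun i => (obsLaw h₁).real (Q.cellU n' i) with hp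
  have hp0 : ∀ i, 0 < p i := hQ.obsLaw_cellU_pos h₁
  -- A guaranteed exit frequency: cell $i$ is visited at least $np_i/2$ times, and a deviation above
  -- $\delta$ makes some cell lose at least the fraction $\delta/(n_vn')$ of its visits.
  set γ : Fin n' → ℝ := fun i => δ / (Q.nv n' * n') * (p i / 2) with hγ
  have hγ0 : ∀ i, 0 < γ i := fun i => by have := hp0 i; positivity
  have hex : ∀ i, ∃ t > 0, (obsLaw h₁).real
      {u | u ∈ Q.cellU n' i ∧ exitGap h₁ h₂ (Q.cellU n' i) u < t} < γ i / 4 := fun i =>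
    exists_exitGap_small hh₁ hh₂ (Q.measurableSet_cellU n' i) (convex_cell _ _ _ _)
      (nonempty_compl_cell _ _ _ _) (by linarith [hγ0 i])
  choose t ht0 ht using hex
  -- Discarding at most $n\gamma_i/2$ cheap exits leaves a mean gap of at least
  -- $t_i\gamma_i/2>2\tau$. The statistic is within $\tau$ of the mean gap, hence above $\tau$.
  have hτ : ∀ᶠ τ in 𝓝[>] (0 : ℝ), (∀ i, τ < t i * γ i / 4) ∧ τ < η ∧ 0 < τ := by
    refine (eventually_all.2 fun i => ?_).and (Eventually.and ?_ self_mem_nhdsWithin)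
    · exact nhdsWithin_le_nhds (eventually_lt_nhds
        (by have := ht0 i; have := hγ0 i; positivity))
    · exact nhdsWithin_le_nhds (eventually_lt_nhds hη)
  obtain ⟨τ, hτi, hτη, hτ0⟩ := hτ.exists
  refine ⟨τ, ⟨hτ0, hτη⟩, fun K hK => ?_⟩
  set A : Fin n' → Set ℝ := fun i =>
    {u | u ∈ Q.cellU n' i ∧ exitGap h₁ h₂ (Q.cellU n' i) u < t i} with hA
  have hAm : ∀ i, MeasurableSet (A i) := fun i => (Q.measurableSet_cellU n' i).inter
    (measurableSet_lt (measurable_exitGap h₁ h₂ _) measurable_const)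
  have t1 := tendsto_statistic_sub_meanGap hh₁ hh₂ hh₃ K hτ0
  have t2 := tendsto_measure_iUnion_zero (fun n => networkLaw h₁ (K n))
    (fun (i : Fin n') n =>
      {ω | p i / 2 ≤ |count (Q.cellU n' i) (seqU h₁ ω) / n - p i|})
    (fun i => tendsto_count (Q.measurableSet_cellU n' i) K (by linarith [hp0 i]))
  have t3 := tendsto_measure_iUnion_zero (fun n => networkLaw h₁ (K n))
    (fun (i : Fin n') n =>
      {ω | γ i / 4 ≤ |count (A i) (seqU h₁ ω) / n - (obsLaw h₁).real (A i)|})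
    (fun i => tendsto_count (hAm i) K (by linarith [hγ0 i]))
  have tt := (t1.add t2).add t3
  simp only [add_zero] at tt
  refine tendsto_of_tendsto_of_tendsto_of_le_of_le' tendsto_const_nhds tt
    (Eventually.of_forall fun n => zero_le) ?_
  filter_upwards [eventually_gt_atTop 0] with n hn
  have hn' : (0 : ℝ) < n := Nat.cast_pos.2 hn
  refine le_trans (measure_mono ?_) ((measure_union_le _ _).trans
    (add_le_add_left (measure_union_le _ _) _))
  rintro ω ⟨hR, hD⟩
  simp only [Set.mem_ofPred_eq, Set.mem_compl_iff, not_lt] at hR hD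
  by_contra hcon
  simp only [Set.mem_union, Set.mem_iUnion, Set.mem_ofPred_eq] at hcon
  push Not at hcon
  obtain ⟨⟨c1, c2⟩, c3⟩ := hcon
  have hcount : ∀ i, p i / 2 * n ≤ count (Q.cellU n' i) (seqU h₁ ω) := fun i => by
    rw [← le_div_iff₀ hn']
    linarith [(abs_lt.1 (c2 i)).1]
  obtain ⟨i, hi⟩ := exists_exitCount_ge hQ hR fun i h => by
    have h1 := hcount i
    have h2 := mul_pos (half_pos (hp0 i)) hn'
    rw [h] at h1
    linarith
  have hexit : γ i * n ≤ exitCount (Q.cellU n' i) (seqU h₁ ω) (seqV ω) := by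
    refine le_trans ?_ hi
    rw [hγ, mul_assoc]
    exact mul_le_mul_of_nonneg_left (hcount i) (by positivity)
  have hA' : count (A i) (seqU h₁ ω) ≤ γ i / 2 * n := by
    rw [← div_le_iff₀ hn']
    linarith [(abs_lt.1 (c3 i)).2, ht i]
  have hgap := mul_exitCount_le hh₁ hh₂ (ht0 i).le (Q.cellU n' i) ω
  have h1 := mul_le_mul_of_nonneg_left hexit (ht0 i).le
  have h2 := mul_le_mul_of_nonneg_left hA' (ht0 i).le
  have hmean : t i * γ i / 2 ≤ meanGap h₁ h₂ ω := by
    rw [meanGap, le_div_iff₀ hn']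
    linarith
  have h3 := hτi i
  linarith [(abs_lt.1 c1).1]

/-- The bound on the statistic for deviations of at most `δ`. -/
def faithfulBound (h₁ h₂ : ℝ) (Q : QuantScheme) (n' : ℕ) (δ : ℝ) : ℝ :=
  4 * |h₁ * h₂| * δ + 4 * |h₁ * h₂| * (|h₂| * step (Q.α₂ n') (Q.β₂ n') (Q.nv n')) +
    4 * |h₁ * h₂| * ((obsLaw h₁).real (Set.Iic (Q.α₂ n') ∪ Set.Ioi (Q.β₂ n')) + δ) + δ

lemma tendsto_faithfulBound (h₁ h₂ : ℝ) (Q : QuantScheme) :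
    Tendsto (Function.uncurry (faithfulBound h₁ h₂ Q)) (atTop ×ˢ 𝓝[>] (0 : ℝ)) (𝓝 0) := by
  have hδ : Tendsto (fun p : ℕ × ℝ => p.2) (atTop ×ˢ 𝓝[>] (0 : ℝ)) (𝓝 0) :=
    (tendsto_id'.2 nhdsWithin_le_nhds).comp tendsto_snd
  have hstep : Tendsto (fun p : ℕ × ℝ => step (Q.α₂ p.1) (Q.β₂ p.1) (Q.nv p.1))
      (atTop ×ˢ 𝓝[>] (0 : ℝ)) (𝓝 0) := Q.tendsto_step₂.comp tendsto_fst
  have htail : Tendsto (fun n' => (obsLaw h₁).real (Set.Iic (Q.α₂ n') ∪ Set.Ioi (Q.β₂ n')))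
      atTop (𝓝 0) := by
    have hlim : Tendsto (fun n' => cdf (obsLaw h₁) (Q.α₂ n') + (1 - cdf (obsLaw h₁) (Q.β₂ n')))
        atTop (𝓝 0) := by
      have := ((tendsto_cdf_atBot (obsLaw h₁)).comp Q.tendsto_α₂).add
        (((tendsto_cdf_atTop (obsLaw h₁)).comp Q.tendsto_β₂).const_sub 1)
      simpa using this
    refine tendsto_of_tendsto_of_tendsto_of_le_of_le tendsto_const_nhds hlim
      (fun _ => measureReal_nonneg) fun n' => (measureReal_union_le _ _).trans (le_of_eq ?_)
    rw [cdf_eq_real, cdf_eq_real, ← Set.compl_Iic, probReal_compl_eq_one_sub measurableSet_Iic]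
  have ht := htail.comp (tendsto_fst (f := (atTop : Filter ℕ)) (g := 𝓝[>] (0 : ℝ)))
  have := (((hδ.const_mul (4 * |h₁ * h₂|)).add
    ((hstep.const_mul |h₂|).const_mul (4 * |h₁ * h₂|))).add
    ((ht.add hδ).const_mul (4 * |h₁ * h₂|))).add hδ
  simp only [mul_zero, add_zero] at this
  exact this

lemma tendsto_false_alarm (hh₁ : h₁ ≠ 0) (hh₂ : h₂ ≠ 0) (hh₃ : h₃ ≠ 0) (hQ : Q.Regular n')
    {δ : ℝ} (hδ : 0 < δ) (K : ∀ n : ℕ, Kernel (Seq n) (Seq n)) [∀ n, IsMarkovKernel (K n)] :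
    Tendsto (fun n => networkLaw h₁ (K n) ({ω | R Q h₁ n' ω ≤ δ} ∩
      {ω | faithfulBound h₁ h₂ Q n' δ < statistic h₁ h₂ h₃ n (seqX h₃ ω) (seqY h₂ ω)}))
      atTop (𝓝 0) := by
  -- The tolerance $\delta$ is spent here and on the tail frequency; this accounts for the last two
  -- $\delta$ in `faithfulBound`.
  have t1 := tendsto_statistic_sub_meanGap hh₁ hh₂ hh₃ K hδ
  have t2 := tendsto_count (h₁ := h₁)
    ((measurableSet_Iic (a := Q.α₂ n')).union (measurableSet_Ioi (a := Q.β₂ n'))) K hδ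
  have tt := t1.add t2
  rw [add_zero] at tt
  refine tendsto_of_tendsto_of_tendsto_of_le_of_le' tendsto_const_nhds tt
    (Eventually.of_forall fun n => zero_le) ?_
  filter_upwards [eventually_gt_atTop 0] with n hn
  refine le_trans (measure_mono ?_) (measure_union_le _ _)
  rintro ω ⟨hR, hD⟩
  simp only [Set.mem_ofPred_eq] at hR hD
  by_contra hcon
  simp only [Set.mem_union, Set.mem_ofPred_eq] at hcon
  push Not at hcon
  obtain ⟨c1, c2⟩ := hcon
  have hm := meanGap_le (h₁ := h₁) (h₂ := h₂) hQ hn ω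
  have hA : 0 ≤ 4 * |h₁ * h₂| := by positivity
  have h1 := mul_le_mul_of_nonneg_left hR hA
  have h2 := mul_le_mul_of_nonneg_left (sub_lt_iff_lt_add'.1 (abs_lt.1 c2).2).le hA
  rw [faithfulBound] at hD
  linarith [(abs_lt.1 c1).2]

end Detection

/-! ### Non-manipulability -/

lemma fUS_eq (h₁ u s : ℝ) :
    fUS h₁ u s = gaussianPDFReal 0 1 u * Real.exp (h₁ * s * u - (h₁ * s) ^ 2 / 2) := by
  rw [fUS, gaussianPDFReal, gaussianPDFReal, mul_assoc _ (Real.exp _), ← Real.exp_add]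
  congr 2
  push_cast
  ring

/-- The density form of $E[S\mid U=u]=\tanh(h_1u)$. -/
lemma fUS_sub_eq_tanh_mul (h₁ u : ℝ) :
    fUS h₁ u 1 - fUS h₁ u (-1) = Real.tanh (h₁ * u) * (fUS h₁ u 1 + fUS h₁ u (-1)) := by
  rw [fUS_eq, fUS_eq, sub_eq_add_neg (h₁ * 1 * u), sub_eq_add_neg (h₁ * -1 * u), Real.exp_add,
    Real.exp_add, Real.tanh_eq]
  have h1 : h₁ * 1 * u = h₁ * u := by ring
  have h2 : h₁ * -1 * u = -(h₁ * u) := by ring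
  have h3 : (h₁ * -1) ^ 2 = (h₁ * 1) ^ 2 := by ring
  rw [h1, h2, h3]
  have h4 : Real.exp (h₁ * u) + Real.exp (-(h₁ * u)) ≠ 0 := by positivity
  field_simp

lemma eq_dirac_of_ae_eq {μ : Measure ℝ} [IsProbabilityMeasure μ] {u : ℝ} (h : ∀ᵐ v ∂μ, v = u) :
    μ = Measure.dirac u := by
  have h' : (id : ℝ → ℝ) =ᵐ[μ] fun _ => u := h
  rw [← Measure.map_id (μ := μ), Measure.map_congr h', Measure.map_const, measure_univ, one_smul]

theorem nonManipulable_of_ne_zero {h₁ h₂ h₃ : ℝ} (hh₁ : h₁ ≠ 0) (hh₂ : h₂ ≠ 0) (hh₃ : h₃ ≠ 0) :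
    NonManipulable h₁ h₂ h₃ := by
  rintro ⟨Ψ, hΨ, hne, heq⟩
  apply hne
  -- The change that $\Psi$ makes in the probability of $Y\le y$ given $U=u$.
  set q : ℝ → ℝ → ℝ := fun y u => (∫ v, FYV h₂ y v ∂(Ψ u)) - FYV h₂ y u with hq
  have hFint : ∀ y u, Integrable (FYV h₂ y) (Ψ u) := fun y u =>
    Integrable.of_bound (measurable_FYV h₂ y).aestronglyMeasurable 1 (ae_of_all _ fun v => by
      rw [Real.norm_eq_abs, abs_of_nonneg (FYV_nonneg _ _ _)]; exact FYV_le_one _ _ _)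
  have hm1 : ∀ y, Measurable fun u => ∫ v, FYV h₂ y v ∂(Ψ u) := fun y =>
    ((measurable_FYV h₂ y).stronglyMeasurable.integral_kernel).measurable
  have hb1 : ∀ y u, ‖∫ v, FYV h₂ y v ∂(Ψ u)‖ ≤ 1 := fun y u => by
    have := norm_integral_le_of_norm_le_const (μ := Ψ u) (f := FYV h₂ y) (C := 1)
      (ae_of_all _ fun v => by
        rw [Real.norm_eq_abs, abs_of_nonneg (FYV_nonneg _ _ _)]; exact FYV_le_one _ _ _)
    simpa using this
  have hfint : ∀ s, Integrable (fun u => fUS h₁ u s) := fun s => integrable_gaussianPDFReal _ _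
  have hi1 : ∀ s y, Integrable fun u => fUS h₁ u s * ∫ v, FYV h₂ y v ∂(Ψ u) := fun s y =>
    (hfint s).mul_bdd (hm1 y).aestronglyMeasurable (ae_of_all _ (hb1 y))
  have hi2 : ∀ s y, Integrable fun u => fUS h₁ u s * FYV h₂ y u := fun s y =>
    (hfint s).mul_bdd (measurable_FYV h₂ y).aestronglyMeasurable (ae_of_all _ fun v => by
      rw [Real.norm_eq_abs, abs_of_nonneg (FYV_nonneg _ _ _)]; exact FYV_le_one _ _ _)
  have hi : ∀ s y, Integrable fun u => fUS h₁ u s * q y u := fun s y => by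
    simp only [hq, mul_sub]
    exact (hi1 s y).sub (hi2 s y)
  set I : ℝ → ℝ → ℝ := fun s y => ∫ u, fUS h₁ u s * q y u with hI
  have hlin : ∀ x y, pSX h₃ 1 x * I 1 y + pSX h₃ (-1) x * I (-1) y = 0 := by
    intro x y
    have e1 : ∫ u, fUX h₁ h₃ u x * (∫ v, FYV h₂ y v ∂(Ψ u)) =
        pSX h₃ 1 x * (∫ u, fUS h₁ u 1 * ∫ v, FYV h₂ y v ∂(Ψ u)) +
          pSX h₃ (-1) x * (∫ u, fUS h₁ u (-1) * ∫ v, FYV h₂ y v ∂(Ψ u)) := by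
      rw [← integral_const_mul, ← integral_const_mul,
        ← integral_add ((hi1 _ _).const_mul _) ((hi1 _ _).const_mul _)]
      exact integral_congr_ae (ae_of_all _ fun u => by simp only [fUX]; ring)
    have e2 : ∫ u, fUX h₁ h₃ u x * FYV h₂ y u =
        pSX h₃ 1 x * (∫ u, fUS h₁ u 1 * FYV h₂ y u) +
          pSX h₃ (-1) x * (∫ u, fUS h₁ u (-1) * FYV h₂ y u) := by
      rw [← integral_const_mul, ← integral_const_mul,
        ← integral_add ((hi2 _ _).const_mul _) ((hi2 _ _).const_mul _)]
      exact integral_congr_ae (ae_of_all _ fun u => by simp only [fUX]; ring)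
    have e3 : ∀ s, I s y = (∫ u, fUS h₁ u s * ∫ v, FYV h₂ y v ∂(Ψ u)) -
        ∫ u, fUS h₁ u s * FYV h₂ y u := fun s => by
      simp only [hI, hq, mul_sub]
      rw [integral_sub (hi1 s y) (hi2 s y)]
    have := heq x y
    rw [e1, e2] at this
    rw [e3, e3]
    linarith
  have hcross : ∀ x y, Real.exp (-(x - h₃ * 1) ^ 2 / 2) * I 1 y +
      Real.exp (-(x - h₃ * (-1)) ^ 2 / 2) * I (-1) y = 0 := by
    intro x y
    have h := hlin x y
    have hpos : 0 < Real.exp (-(x - h₃ * 1) ^ 2 / 2) + Real.exp (-(x - h₃ * (-1)) ^ 2 / 2) := by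
      positivity
    rw [pSX, pSX, div_mul_eq_mul_div, div_mul_eq_mul_div, ← add_div, div_eq_zero_iff] at h
    exact h.resolve_right hpos.ne'
  -- Two observations suffice: $x=0$ weights both symbols equally, and $x=1$ does not, because
  -- $h_3\ne0$.
  have hI0 : ∀ y, I 1 y = 0 ∧ I (-1) y = 0 := by
    intro y
    have h0 := hcross 0 y
    have h1 := hcross 1 y
    have e : (0 - h₃ * (-1)) ^ 2 = (0 - h₃ * 1) ^ 2 := by ring
    rw [e, ← mul_add] at h0
    have hs : I 1 y + I (-1) y = 0 := (mul_eq_zero.1 h0).resolve_left (Real.exp_pos _).ne'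
    have hI' : I (-1) y = -I 1 y := by linarith
    rw [hI', mul_neg, ← sub_eq_add_neg, ← sub_mul] at h1
    have hne' : Real.exp (-(1 - h₃ * 1) ^ 2 / 2) - Real.exp (-(1 - h₃ * (-1)) ^ 2 / 2) ≠ 0 := by
      rw [sub_ne_zero]
      intro h
      have := Real.exp_injective h
      apply hh₃
      linarith
    have h2 := (mul_eq_zero.1 h1).resolve_left hne'
    exact ⟨h2, by rw [hI', h2, neg_zero]⟩
  set c := h₁ / h₂ with hc
  have hgapint : ∀ u, ∫ v, gap h₁ h₂ u v ∂(Ψ u) =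
      -(h₁ * h₂) * ((q c u - q (-c) u) - Real.tanh (h₁ * u) * (q c u + q (-c) u)) := by
    intro u
    have ip := hFint c u
    have im := hFint (-c) u
    have e : ∀ v, gap h₁ h₂ u v = -(h₁ * h₂) * ((1 - Real.tanh (h₁ * u)) * FYV h₂ c v -
        (1 + Real.tanh (h₁ * u)) * FYV h₂ (-c) v - regr h₁ h₂ u u) := fun v => by
      simp only [gap, regr]
      ring
    have hpm : Integrable (fun v => (1 - Real.tanh (h₁ * u)) * FYV h₂ c v -
        (1 + Real.tanh (h₁ * u)) * FYV h₂ (-c) v) (Ψ u) := (ip.const_mul _).sub (im.const_mul _)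
    simp_rw [e]
    rw [integral_const_mul, integral_sub hpm (integrable_const _), integral_sub (ip.const_mul _) (im.const_mul _), integral_const_mul,
      integral_const_mul]
    simp only [integral_const, probReal_univ, one_smul, hq, regr]
    ring
  set Z : ℝ → ℝ := fun u => (fUS h₁ u 1 + fUS h₁ u (-1)) * ∫ v, gap h₁ h₂ u v ∂(Ψ u) with hZ
  have hf0 : ∀ u, 0 < fUS h₁ u 1 + fUS h₁ u (-1) := fun u =>
    add_pos (gaussianPDFReal_pos _ _ _ one_ne_zero) (gaussianPDFReal_pos _ _ _ one_ne_zero)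
  -- Weighting by the sum of the two densities turns $\tanh$ into their difference. What survives
  -- pairs the symbol $1$ with the threshold $-c$ and the symbol $-1$ with $c$.
  have hZeq : Z = fun u => (2 * (h₁ * h₂)) * (fUS h₁ u 1 * q (-c) u) -
      (2 * (h₁ * h₂)) * (fUS h₁ u (-1) * q c u) := by
    funext u
    have h := fUS_sub_eq_tanh_mul h₁ u
    simp only [hZ, hgapint]
    linear_combination (h₁ * h₂) * (-(q c u + q (-c) u)) * h
  have hZint : Integrable Z := by
    rw [hZeq]
    exact ((hi _ _).const_mul _).sub ((hi _ _).const_mul _)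
  have hZ0 : ∫ u, Z u = 0 := by
    rw [hZeq, integral_sub ((hi _ _).const_mul _) ((hi _ _).const_mul _), integral_const_mul,
      integral_const_mul]
    change 2 * (h₁ * h₂) * I 1 (-c) - 2 * (h₁ * h₂) * I (-1) c = 0
    rw [(hI0 (-c)).1, (hI0 c).2]
    ring
  have hgapn : ∀ u v, 0 ≤ gap h₁ h₂ u v := gap_nonneg hh₁ hh₂
  have hZnn : 0 ≤ Z := fun u => mul_nonneg (hf0 u).le (integral_nonneg fun v => hgapn u v)
  have hae := (integral_eq_zero_iff_of_nonneg hZnn hZint).1 hZ0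
  filter_upwards [hae] with u hu
  have h0 : ∫ v, gap h₁ h₂ u v ∂(Ψ u) = 0 := (mul_eq_zero.1 hu).resolve_left (hf0 u).ne'
  have hgi : Integrable (gap h₁ h₂ u) (Ψ u) := by
    have hm : Measurable (gap h₁ h₂ u) :=
      ((continuous_gap h₁ h₂).comp (f := fun v => (u, v)) (by fun_prop)).measurable
    refine Integrable.of_bound hm.aestronglyMeasurable (4 * |h₁ * h₂|) (ae_of_all _ fun v => ?_)
    rw [Real.norm_eq_abs, abs_of_nonneg (hgapn u v)]
    exact gap_le_const h₁ h₂ u v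
  have hg := (integral_eq_zero_iff_of_nonneg (fun v => hgapn u v) hgi).1 h0
  apply eq_dirac_of_ae_eq
  filter_upwards [hg] with v hv
  by_contra hvu
  exact (gap_pos hh₁ hh₂ hvu).ne' hv

/-- Sign reversal is invisible. If $h_2=0$, $Y$ ignores $V$. If $h_1=0$ or $h_3=0$, the density of
$U$ given $X=x$ is even: either $U$ is pure noise or $X$ says nothing about $S$. -/
theorem manipulable_of_eq_zero {h₁ h₂ h₃ : ℝ} (h : h₁ = 0 ∨ h₂ = 0 ∨ h₃ = 0) :
    Manipulable h₁ h₂ h₃ := by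
  refine ⟨Kernel.deterministic (fun u => -u) measurable_neg, inferInstance, ?_, ?_⟩
  · intro hae
    have hne : ∀ᵐ u : ℝ, u ≠ 0 := by simp [ae_iff]
    obtain ⟨u, hu, hu0⟩ := (hae.and hne).exists
    rw [Kernel.deterministic_apply] at hu
    have := dirac_eq_dirac_iff.1 hu
    exact hu0 (by linarith)
  · intro x y
    simp only [Kernel.deterministic_apply, integral_dirac]
    by_cases h2 : h₂ = 0
    · subst h2
      simp [FYV]
    have hsym : ∀ u, fUX h₁ h₃ (-u) x = fUX h₁ h₃ u x := by
      intro u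
      have hneg : ∀ m, gaussianPDFReal m 1 (-u) = gaussianPDFReal (-m) 1 u := fun m => by
        simp only [gaussianPDFReal]
        ring_nf
      rcases h with h | h | h
      · simp [h, fUX, fUS, hneg]
      · exact absurd h h2
      · simp only [h, fUX, fUS, pSX, hneg, zero_mul]
        simp only [mul_one, mul_neg, neg_neg]
        ring
    calc ∫ u, fUX h₁ h₃ u x * FYV h₂ y (-u) = ∫ u, fUX h₁ h₃ (-u) x * FYV h₂ y (-u) := by
          simp_rw [hsym]
      _ = ∫ u, fUX h₁ h₃ u x * FYV h₂ y u :=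
          integral_neg_eq_self (fun u => fUX h₁ h₃ u x * FYV h₂ y u) volume

/-! ### Undetectable attacks -/

lemma networkLaw_deterministic (h₁ : ℝ) {n : ℕ} {g : Seq n → Seq n} (hg : Measurable g) :
    networkLaw h₁ (Kernel.deterministic g hg) =
      (primitiveLaw n).map fun w => (w, g (relayInput h₁ w)) := by
  have : (Kernel.deterministic g hg).comap (relayInput h₁) (measurable_relayInput h₁ n) =
      Kernel.deterministic (fun w => g (relayInput h₁ w))
        (hg.comp (measurable_relayInput h₁ n)) := rfl
  rw [networkLaw, this, Measure.compProd_deterministic]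

lemma measurePreserving_neg_symbolLaw : MeasurePreserving (fun s : ℝ => -s) symbolLaw symbolLaw := by
  refine ⟨measurable_neg, ?_⟩
  rw [symbolLaw, Measure.map_smul, Measure.map_add _ _ measurable_neg,
    Measure.map_dirac' measurable_neg, Measure.map_dirac' measurable_neg, neg_neg, add_comm]

lemma measurePreserving_neg_gaussian :
    MeasurePreserving (fun s : ℝ => -s) (gaussianReal 0 1) (gaussianReal 0 1) :=
  ⟨measurable_neg, by rw [gaussianReal_map_neg, neg_zero]⟩

/-- With a vanishing coefficient, some symmetry of the primitives reverses the relay's input and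
preserves the direct observation. -/
lemma exists_symmetry {h₁ h₃ : ℝ} (h : h₁ = 0 ∨ h₃ = 0) (n : ℕ) :
    ∃ σ : Primitive n → Primitive n, MeasurePreserving σ (primitiveLaw n) (primitiveLaw n) ∧
      (∀ w, relayInput h₁ (σ w) = -relayInput h₁ w) ∧
      (∀ w v v', seqX h₃ (σ w, v) = seqX h₃ (w, v')) ∧ ∀ w, (σ w).2.2.2 = w.2.2.2 := by
  have hz : MeasurePreserving (fun (z : Seq n) l => -z l)
      (Measure.pi fun _ : Fin n => gaussianReal 0 1) (Measure.pi fun _ => gaussianReal 0 1) :=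
    measurePreserving_pi _ _ fun _ => measurePreserving_neg_gaussian
  have hs : MeasurePreserving (fun (s : Seq n) l => -s l)
      (Measure.pi fun _ : Fin n => symbolLaw) (Measure.pi fun _ => symbolLaw) :=
    measurePreserving_pi _ _ fun _ => measurePreserving_neg_symbolLaw
  have hid := fun (μ : Measure (Seq n × Seq n)) => MeasurePreserving.id μ
  -- For $h_1=0$ only the relay noise is reversed; for $h_3=0$ both the symbols and the relay noise
  -- are.
  rcases h with h | h
  · refine ⟨_, (MeasurePreserving.id _).prod (hz.prod (hid _)), fun w => ?_, fun w v v' => rfl,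
      fun w => rfl⟩
    funext l
    simp [relayInput, h]
  · refine ⟨_, hs.prod (hz.prod (hid _)), fun w => ?_, fun w v v' => ?_, fun w => rfl⟩
    · funext l
      simp [relayInput]
      ring
    · funext l
      simp [seqX, h]

lemma measurableSet_lt_decision (h₂ h₃ : ℝ) {n : ℕ} {D : Seq n → Seq n → ℝ}
    (hD : Measurable (Function.uncurry D)) (c : ℝ) :
    MeasurableSet {ω : Primitive n × Seq n | c < D (seqX h₃ ω) (seqY h₂ ω)} :=
  measurableSet_lt measurable_const
    (hD.comp (f := fun ω => (seqX h₃ ω, seqY h₂ ω)) (by fun_prop))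

/-- The sign-reversing attack cannot be told from faithful forwarding. -/
lemma networkLaw_neg_eq {h₁ h₂ h₃ : ℝ} (h : h₁ = 0 ∨ h₂ = 0 ∨ h₃ = 0) {n : ℕ}
    {D : Seq n → Seq n → ℝ} (hD : Measurable (Function.uncurry D)) (c : ℝ) :
    networkLaw h₁ (Kernel.deterministic (fun u : Seq n => -u) measurable_neg)
        {ω | c < D (seqX h₃ ω) (seqY h₂ ω)} =
      networkLaw h₁ (Kernel.deterministic (fun u : Seq n => u) measurable_id)
        {ω | c < D (seqX h₃ ω) (seqY h₂ ω)} := by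
  have hmeas : MeasurableSet {ω : Primitive n × Seq n | c < D (seqX h₃ ω) (seqY h₂ ω)} :=
    measurableSet_lt_decision h₂ h₃ hD c
  have hr := measurable_relayInput h₁ n
  rw [networkLaw_deterministic, networkLaw_deterministic, Measure.map_apply (by fun_prop) hmeas,
    Measure.map_apply (by fun_prop) hmeas]
  by_cases h2 : h₂ = 0
  · subst h2
    congr 1
    ext w
    have hY : ∀ v v' : Seq n, seqY 0 (w, v) = seqY 0 (w, v') := fun v v' => by
      funext l
      simp [seqY]
    have hX : ∀ v v' : Seq n, seqX h₃ (w, v) = seqX h₃ (w, v') := fun v v' => rfl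
    simp only [Set.mem_preimage, Set.mem_ofPred_eq, hY _ 0, hX _ 0]
  obtain ⟨σ, hσ, hrel, hX, hN⟩ := exists_symmetry (h₁ := h₁) (h₃ := h₃) (by tauto) n
  rw [← hσ.measure_preimage (s := (fun w => (w, relayInput h₁ w)) ⁻¹'
    {ω | c < D (seqX h₃ ω) (seqY h₂ ω)})
    ((by fun_prop : Measurable fun w => (w, relayInput h₁ w)) hmeas).nullMeasurableSet]
  congr 1
  ext w
  have hY : seqY h₂ (w, -relayInput h₁ w) = seqY h₂ (σ w, relayInput h₁ (σ w)) := by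
    funext l
    simp only [seqY, seqV, hN, hrel]
  simp only [Set.mem_preimage, Set.mem_ofPred_eq, hY, hX w _ (-relayInput h₁ w)]

lemma ae_seqV_deterministic (h₁ : ℝ) {n : ℕ} {g : Seq n → Seq n} (hg : Measurable g) :
    ∀ᵐ ω ∂(networkLaw h₁ (Kernel.deterministic g hg)), seqV ω = g (seqU h₁ ω) := by
  have hr := measurable_relayInput h₁ n
  have hm : MeasurableSet {ω : Primitive n × Seq n | seqV ω = g (seqU h₁ ω)} :=
    measurableSet_eq_fun (measurable_seqV n) (hg.comp (measurable_seqU h₁ n))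
  rw [networkLaw_deterministic, ae_map_iff (by fun_prop) hm]
  exact ae_of_all _ fun w => rfl

/-- An unvisited cell has a zero row in `empKernel`, which differs from the identity even under
faithful forwarding, so this event has to be removed. -/
lemma tendsto_unvisited {Q : QuantScheme} {n' : ℕ} (hQ : Q.Regular n') (h₁ : ℝ)
    (K : ∀ n : ℕ, Kernel (Seq n) (Seq n)) [∀ n, IsMarkovKernel (K n)] :
    Tendsto (fun n => networkLaw h₁ (K n)
      (⋃ i, {ω | count (Q.cellU n' i) (seqU h₁ ω) = 0})) atTop (𝓝 0) := by
  refine tendsto_measure_iUnion_zero (fun n => networkLaw h₁ (K n))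
    (fun (i : Fin n') n => {ω | count (Q.cellU n' i) (seqU h₁ ω) = 0}) fun i => ?_
  refine tendsto_of_tendsto_of_tendsto_of_le_of_le tendsto_const_nhds
    (tendsto_count (Q.measurableSet_cellU n' i) K (hQ.obsLaw_cellU_pos h₁ i))
    (fun n => zero_le) fun n => measure_mono fun ω hω => ?_
  simp only [Set.mem_ofPred_eq] at hω ⊢
  rw [hω, zero_div, zero_sub, abs_neg]
  exact le_abs_self _

lemma deviation_self {Q : QuantScheme} {n' : ℕ} (hQ : Q.Regular n') {n : ℕ} {u : Seq n}
    (hc : ∀ i, count (Q.cellU n' i) u ≠ 0) : deviation Q n' u u = 0 := by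
  refine Finset.sum_eq_zero fun j _ => Finset.sum_eq_zero fun i _ => ?_
  have h := abs_empKernel_sub_le hQ u u i j (hc i)
  have h0 : exitCount (Q.cellU n' i) u u = 0 := Finset.sum_eq_zero fun l _ => by
    by_cases hl : u l ∈ Q.cellU n' i
    · rw [Set.indicator_of_notMem (s := (Q.cellU n' i)ᶜ) (by simpa using hl), mul_zero]
    · rw [Set.indicator_of_notMem hl, zero_mul]
  rw [h0] at h
  have hc0 : 0 < count (Q.cellU n' i) u := lt_of_le_of_ne (count_nonneg _ _) (hc i).symm
  exact le_antisymm (nonpos_of_mul_nonpos_left h hc0) (abs_nonneg _)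

/-- The input cell containing $\beta_2+1$ lies in the last output cell $(\beta_2,\infty)$. As
$\beta_2>0$, reversal sends all its inputs out of that cell, so an entry that should be $1$ is $0$.
-/
lemma one_le_deviation_neg {Q : QuantScheme} {n' : ℕ} (hQ : Q.Regular n') (hβ : 0 < Q.β₂ n')
    {n : ℕ} {u : Seq n} (hc : ∀ i, count (Q.cellU n' i) u ≠ 0) :
    1 ≤ deviation Q n' u (-u) := by
  have h3 := hQ.three_le_nv
  obtain ⟨i, hi⟩ := exists_mem_cell hQ.lt₁ hQ.three_le (Q.β₂ n' + 1)
  set j : Fin (Q.nv n') := ⟨Q.nv n' - 1, by omega⟩ with hj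
  have hV : Q.cellV n' j = Set.Ioi (Q.β₂ n') := by
    simp only [QuantScheme.cellV, cell, hj]
    rw [if_neg (by omega), if_pos (by omega)]
  have hsub : Q.cellU n' i ⊆ Q.cellV n' j := (hQ.nested i j).resolve_right fun hd =>
    Set.disjoint_left.1 hd hi (by rw [hV]; simp)
  have h0 : empKernel Q n' u (-u) i j = 0 := by
    rw [empKernel, if_neg (hc i), Finset.sum_eq_zero, zero_div]
    intro l _
    by_cases hl : u l ∈ Q.cellU n' i
    · have h1 : Q.β₂ n' < u l := by
        have := hsub hl
        rwa [hV] at this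
      rw [Set.indicator_of_notMem, zero_mul]
      rw [hV, Set.mem_Ioi, Pi.neg_apply]
      linarith
    · rw [Set.indicator_of_notMem hl, mul_zero]
  have h1 : |empKernel Q n' u (-u) i j - idKernel Q n' i j| = 1 := by
    rw [h0, idKernel, if_pos hsub]
    norm_num
  rw [← h1, deviation]
  refine le_trans ?_ (Finset.single_le_sum
    (f := fun j => ∑ i, |empKernel Q n' u (-u) i j - idKernel Q n' i j|)
    (fun j _ => Finset.sum_nonneg fun i _ => abs_nonneg _) (Finset.mem_univ j))
  exact Finset.single_le_sum (f := fun i => |empKernel Q n' u (-u) i j - idKernel Q n' i j|)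
    (fun i _ => abs_nonneg _) (Finset.mem_univ i)

lemma liminf_pos_of_compl_tendsto_zero {Ω : ℕ → Type*} [∀ n, MeasurableSpace (Ω n)]
    (μ : ∀ n, Measure (Ω n)) [∀ n, IsProbabilityMeasure (μ n)] {A : ∀ n, Set (Ω n)}
    (hA : ∀ n, MeasurableSet (A n)) (h : Tendsto (fun n => μ n (A n)ᶜ) atTop (𝓝 0)) :
    0 < liminf (fun n => μ n (A n)) atTop := by
  have h1 : Tendsto (fun n => 1 - μ n (A n)ᶜ) atTop (𝓝 (1 - 0)) :=
    ENNReal.Tendsto.sub tendsto_const_nhds h (Or.inl ENNReal.one_ne_top)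
  have h2 : Tendsto (fun n => μ n (A n)) atTop (𝓝 1) := by
    rw [tsub_zero] at h1
    refine h1.congr fun n => ?_
    rw [← prob_compl_eq_one_sub (hA n).compl, compl_compl]
  rw [h2.liminf_eq]
  exact zero_lt_one

/-! ### The detection property -/

/-- The statistics `D` detect attacks, with false-alarm level `μ'`. -/
def Detects (h₁ h₂ h₃ : ℝ) (Q : QuantScheme) (D : ∀ n : ℕ, Seq n → Seq n → ℝ)
    (μ' : ℕ → ℝ → ℝ) : Prop :=
  ∀ η : ℝ, 0 < η → ∃ thr : ℕ → ℝ → ℝ,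
    (∀ n' δ, 0 < δ → 0 < thr n' δ ∧ thr n' δ < η) ∧
    ∃ δ₀ > (0 : ℝ), ∃ ε₀ > (0 : ℝ),
      ∀ δ : ℝ, 0 < δ → δ < δ₀ → ∀ ε : ℝ, 0 < ε → ε < ε₀ →
      ∃ N : ℕ, ∀ n' ≥ N,
      ∀ K : ∀ n : ℕ, Kernel (Seq n) (Seq n),
        (∀ n, IsMarkovKernel (K n)) →
        (0 < liminf (fun n => networkLaw h₁ (K n)
              {ω | δ < R Q h₁ n' ω}) atTop →
          ∃ L : ℝ, 1 - ε ≤ L ∧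
            Tendsto (fun n =>
              (cond (networkLaw h₁ (K n))
                {ω | δ < R Q h₁ n' ω}).real
                {ω | thr n' δ < D n (seqX h₃ ω) (seqY h₂ ω)})
              atTop (𝓝 L)) ∧
        (0 < liminf (fun n => networkLaw h₁ (K n)
              {ω | R Q h₁ n' ω < δ}) atTop →
          ∃ L : ℝ, L ≤ ε ∧
            Tendsto (fun n =>
              (cond (networkLaw h₁ (K n))
                {ω | R Q h₁ n' ω ≤ δ}).real
                {ω | μ' n' δ < D n (seqX h₃ ω) (seqY h₂ ω)})
              atTop (𝓝 L))

theorem detectable_of_ne_zero {h₁ h₂ h₃ : ℝ} (Q : QuantScheme) (hh₁ : h₁ ≠ 0) (hh₂ : h₂ ≠ 0)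
    (hh₃ : h₃ ≠ 0) :
    ∃ D : ∀ n : ℕ, Seq n → Seq n → ℝ, (∀ n, Measurable (Function.uncurry (D n))) ∧
      ∃ μ' : ℕ → ℝ → ℝ, Tendsto (Function.uncurry μ') (atTop ×ˢ 𝓝[>] (0 : ℝ)) (𝓝 0) ∧
        Detects h₁ h₂ h₃ Q D μ' := by
  classical
  refine ⟨statistic h₁ h₂ h₃, measurable_statistic h₁ h₂ h₃, faithfulBound h₁ h₂ Q,
    tendsto_faithfulBound h₁ h₂ Q, fun η hη => ?_⟩
  have hex : ∀ n' δ, ∃ τ, 0 < δ → (0 < τ ∧ τ < η) ∧ (Q.Regular n' →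
      ∀ K : ∀ n : ℕ, Kernel (Seq n) (Seq n), (∀ n, IsMarkovKernel (K n)) →
      Tendsto (fun n => networkLaw h₁ (K n) ({ω | δ < R Q h₁ n' ω} ∩
        {ω | τ < statistic h₁ h₂ h₃ n (seqX h₃ ω) (seqY h₂ ω)}ᶜ)) atTop (𝓝 0)) := by
    intro n' δ
    by_cases hδ : 0 < δ
    · by_cases hQ : Q.Regular n'
      · obtain ⟨τ, h1, h2⟩ := exists_threshold hh₁ hh₂ hh₃ hQ hδ hη
        exact ⟨τ, fun _ => ⟨h1, fun _ => h2⟩⟩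
      -- At degenerate levels nothing is to be detected; the threshold only has to lie in
      -- $(0,\eta)$.
      · exact ⟨η / 2, fun _ => ⟨⟨by linarith, by linarith⟩, fun h => absurd h hQ⟩⟩
    · exact ⟨0, fun h => absurd h hδ⟩
  choose thr hthr using hex
  -- The bounds $1$ on $\delta$ and $\epsilon$ are arbitrary: the limits are exactly $1$ and $0$ for
  -- all positive values.
  refine ⟨thr, fun n' δ hδ => (hthr n' δ hδ).1, 1, one_pos, 1, one_pos,
    fun δ hδ _ ε hε _ => ?_⟩
  obtain ⟨N, hN⟩ := eventually_atTop.1 Q.eventually_regular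
  refine ⟨N, fun n' hn' K hK => ⟨fun hpos => ⟨1, by linarith, ?_⟩, fun hpos => ⟨0, hε.le, ?_⟩⟩⟩
  · refine tendsto_cond_one (fun n => networkLaw h₁ (K n))
      (fun n => measurableSet_lt measurable_const (measurable_R Q h₁ n' n)) (fun n => ?_) hpos
      ((hthr n' δ hδ).2 (hN n' hn') K hK)
    exact measurableSet_lt_decision h₂ h₃ (measurable_statistic h₁ h₂ h₃ n) _
  · exact tendsto_cond_zero (fun n => networkLaw h₁ (K n))
      (A := fun n => {ω | R Q h₁ n' ω ≤ δ}) (A' := fun n => {ω | R Q h₁ n' ω < δ})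
      (fun n => measurableSet_le (measurable_R Q h₁ n' n) measurable_const)
      (fun n ω hω => le_of_lt (α := ℝ) hω) hpos
      (tendsto_false_alarm hh₁ hh₂ hh₃ (hN n' hn') hδ K)

/-- Faithful forwarding. -/
def faithful (n : ℕ) : Kernel (Seq n) (Seq n) :=
  Kernel.deterministic (fun u => u) measurable_id

/-- The attack that reverses signs. -/
def reversal (n : ℕ) : Kernel (Seq n) (Seq n) :=
  Kernel.deterministic (fun u => -u) measurable_neg

instance (n : ℕ) : IsMarkovKernel (faithful n) := by unfold faithful; infer_instance

instance (n : ℕ) : IsMarkovKernel (reversal n) := by unfold reversal; infer_instance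

lemma tendsto_faithful_deviation {Q : QuantScheme} {n' : ℕ} (hQ : Q.Regular n') (h₁ : ℝ) {δ : ℝ}
    (hδ : 0 < δ) :
    Tendsto (fun n => networkLaw h₁ (faithful n) {ω | R Q h₁ n' ω < δ}ᶜ) atTop (𝓝 0) := by
  refine tendsto_of_tendsto_of_tendsto_of_le_of_le tendsto_const_nhds
    (tendsto_unvisited hQ h₁ faithful) (fun n => zero_le) fun n => measure_mono_ae ?_
  filter_upwards [ae_seqV_deterministic h₁ (n := n) (g := fun u => u) measurable_id] with ω hω hR
  by_contra hcon
  have hc : ∀ i, count (Q.cellU n' i) (seqU h₁ ω) ≠ 0 := fun i h =>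
    hcon (Set.mem_iUnion.2 ⟨i, h⟩)
  refine hR ?_
  change deviation Q n' (seqU h₁ ω) (seqV ω) < δ
  rw [hω, deviation_self hQ hc]
  exact hδ

lemma tendsto_reversal_deviation {Q : QuantScheme} {n' : ℕ} (hQ : Q.Regular n')
    (hβ : 0 < Q.β₂ n') (h₁ : ℝ) {δ : ℝ} (hδ : δ < 1) :
    Tendsto (fun n => networkLaw h₁ (reversal n) {ω | δ < R Q h₁ n' ω}ᶜ) atTop (𝓝 0) := by
  refine tendsto_of_tendsto_of_tendsto_of_le_of_le tendsto_const_nhds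
    (tendsto_unvisited hQ h₁ reversal) (fun n => zero_le) fun n => measure_mono_ae ?_
  filter_upwards [ae_seqV_deterministic h₁ (n := n) (g := fun u => -u) measurable_neg] with ω hω hR
  by_contra hcon
  have hc : ∀ i, count (Q.cellU n' i) (seqU h₁ ω) ≠ 0 := fun i h =>
    hcon (Set.mem_iUnion.2 ⟨i, h⟩)
  refine hR ?_
  change δ < deviation Q n' (seqU h₁ ω) (seqV ω)
  rw [hω]
  exact hδ.trans_le (one_le_deviation_neg hQ hβ hc)

/-- Under faithful forwarding, detecting statistics do not exceed any positive level. -/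
lemma Detects.tendsto_faithful {h₁ h₂ h₃ : ℝ} {Q : QuantScheme}
    {D : ∀ n : ℕ, Seq n → Seq n → ℝ} {μ' : ℕ → ℝ → ℝ}
    (hμ' : Tendsto (Function.uncurry μ') (atTop ×ˢ 𝓝[>] (0 : ℝ)) (𝓝 0))
    (hdet : Detects h₁ h₂ h₃ Q D μ') {c : ℝ} (hc : 0 < c) :
    Tendsto (fun n => networkLaw h₁ (faithful n) {ω | c < D n (seqX h₃ ω) (seqY h₂ ω)})
      atTop (𝓝 0) := by
  suffices h : Tendsto (fun n => (networkLaw h₁ (faithful n)).real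
      {ω | c < D n (seqX h₃ ω) (seqY h₂ ω)}) atTop (𝓝 0) by
    have h' := ENNReal.tendsto_ofReal h
    simpa using h'
  obtain ⟨thr, -, δ₀, hδ₀, ε₀, hε₀, hall⟩ := hdet 1 one_pos
  rw [Metric.tendsto_atTop']
  intro e he
  -- The statistics do not depend on $n'$ and $\delta$, so these are free to be chosen with
  -- $\mu'(n',\delta)<c$, and $\epsilon$ below the target accuracy.
  obtain ⟨pa, hpa, pb, hpb, hab⟩ := eventually_prod_iff.1 (hμ'.eventually_lt_const hc)
  have hδev : ∀ᶠ δ in 𝓝[>] (0 : ℝ), pb δ ∧ δ < δ₀ ∧ 0 < δ :=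
    hpb.and (Eventually.and (nhdsWithin_le_nhds (eventually_lt_nhds hδ₀)) self_mem_nhdsWithin)
  obtain ⟨δ, hδb, hδδ₀, hδ⟩ := hδev.exists
  obtain ⟨ε, hε, hεe, hεε₀⟩ : ∃ ε, 0 < ε ∧ ε < e ∧ ε < ε₀ := by
    obtain ⟨ε, h1, h2⟩ := exists_between (lt_min he hε₀)
    exact ⟨ε, h1, h2.trans_le (min_le_left _ _), h2.trans_le (min_le_right _ _)⟩
  obtain ⟨N, hN⟩ := hall δ hδ hδδ₀ ε hε hεε₀
  obtain ⟨n', hn'a, hn'Q, hn'N⟩ :=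
    (hpa.and (Q.eventually_regular.and (eventually_ge_atTop N))).exists
  have hlow : μ' n' δ < c := hab hn'a hδb
  have hbad := tendsto_faithful_deviation hn'Q h₁ hδ
  obtain ⟨L, hL, hlim⟩ := (hN n' hn'N faithful (fun n => inferInstance)).2
    (liminf_pos_of_compl_tendsto_zero (fun n => networkLaw h₁ (faithful n))
      (fun n => measurableSet_lt (measurable_R Q h₁ n' n) measurable_const) hbad)
  have hbad' := (ENNReal.tendsto_toReal ENNReal.zero_ne_top).comp hbad
  have hsum := hbad'.add hlim
  have hlt : ENNReal.toReal 0 + L < e := by simpa using hL.trans_lt hεe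
  obtain ⟨M, hM⟩ := eventually_atTop.1 (hsum.eventually_lt_const hlt)
  refine ⟨M, fun n hn => ?_⟩
  rw [Real.dist_eq, sub_zero, abs_of_nonneg measureReal_nonneg]
  refine lt_of_le_of_lt ?_ (hM n hn.le)
  set P := networkLaw h₁ (faithful n)
  set A : Set (Primitive n × Seq n) := {ω | R Q h₁ n' ω ≤ δ}
  set T : Set (Primitive n × Seq n) := {ω | μ' n' δ < D n (seqX h₃ ω) (seqY h₂ ω)}
  have hA : MeasurableSet A := measurableSet_le (measurable_R Q h₁ n' n) measurable_const
  have h1 : P.real {ω | c < D n (seqX h₃ ω) (seqY h₂ ω)} ≤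
      P.real {ω | R Q h₁ n' ω < δ}ᶜ + P.real (A ∩ T) := by
    refine (measureReal_mono ?_).trans (measureReal_union_le _ _)
    intro ω hω
    by_cases hR : R Q h₁ n' ω < δ
    · exact Or.inr ⟨hR.le, hlow.trans hω⟩
    · exact Or.inl hR
  have h2 : P.real (A ∩ T) ≤ (ProbabilityTheory.cond P A).real T := by
    rw [measureReal_def, measureReal_def, ← cond_mul_eq_inter hA, ENNReal.toReal_mul]
    exact mul_le_of_le_one_right ENNReal.toReal_nonneg measureReal_le_one
  exact h1.trans (add_le_add_right h2 _)

theorem not_detects_of_eq_zero {h₁ h₂ h₃ : ℝ} (Q : QuantScheme)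
    (hzero : h₁ = 0 ∨ h₂ = 0 ∨ h₃ = 0) {D : ∀ n : ℕ, Seq n → Seq n → ℝ}
    (hD : ∀ n, Measurable (Function.uncurry (D n))) {μ' : ℕ → ℝ → ℝ}
    (hμ' : Tendsto (Function.uncurry μ') (atTop ×ˢ 𝓝[>] (0 : ℝ)) (𝓝 0)) :
    ¬ Detects h₁ h₂ h₃ Q D μ' := by
  intro hdet
  obtain ⟨thr, hthr, δ₀, hδ₀, ε₀, hε₀, hall⟩ := hdet 1 one_pos
  -- Reversal is only known to have deviation at least $1$, hence $\delta<1$; below, $\epsilon<1$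
  -- makes the required detection probability positive.
  obtain ⟨δ, hδ, hδ'⟩ := exists_between (lt_min hδ₀ one_pos)
  obtain ⟨ε, hε, hε'⟩ := exists_between (lt_min hε₀ one_pos)
  obtain ⟨N, hN⟩ := hall δ hδ (hδ'.trans_le (min_le_left _ _)) ε hε
    (hε'.trans_le (min_le_left _ _))
  obtain ⟨n', hQ, hβ, hn'⟩ := (Q.eventually_regular.and
    ((Q.tendsto_β₂.eventually_gt_atTop 0).and (eventually_ge_atTop N))).exists
  have hpos := liminf_pos_of_compl_tendsto_zero (fun n => networkLaw h₁ (reversal n))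
    (fun n => measurableSet_lt measurable_const (measurable_R Q h₁ n' n))
    (tendsto_reversal_deviation hQ hβ h₁ (hδ'.trans_le (min_le_right _ _)))
  obtain ⟨L, hL, hlim⟩ := (hN n' hn' reversal (fun n => inferInstance)).1 hpos
  have hsmall : Tendsto (fun n => networkLaw h₁ (reversal n)
      {ω | thr n' δ < D n (seqX h₃ ω) (seqY h₂ ω)}) atTop (𝓝 0) :=
    (Detects.tendsto_faithful hμ' hdet (hthr n' δ hδ).1).congr fun n =>
      (networkLaw_neg_eq hzero (hD n) _).symm
  have hzero' := tendsto_cond_zero (fun n => networkLaw h₁ (reversal n))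
    (A := fun n => {ω | δ < R Q h₁ n' ω}) (A' := fun n => {ω | δ < R Q h₁ n' ω})
    (T := fun n => {ω | thr n' δ < D n (seqX h₃ ω) (seqY h₂ ω)})
    (fun n => measurableSet_lt measurable_const (measurable_R Q h₁ n' n))
    (fun n => subset_rfl) hpos
    (tendsto_of_tendsto_of_tendsto_of_le_of_le tendsto_const_nhds hsmall (fun n => zero_le)
      fun n => measure_mono Set.inter_subset_right)
  have hL0 := tendsto_nhds_unique hlim hzero'
  have := hε'.trans_le (min_le_right _ _)
  linarith

end RelayNetwork

end

/-! ### The equivalence of non-manipulability and detectability. -/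

theorem theorem1 (h₁ h₂ h₃ : ℝ) (Q : RelayNetwork.QuantScheme) :
    RelayNetwork.NonManipulable h₁ h₂ h₃ ↔
      ∃ D : ∀ n : ℕ, RelayNetwork.Seq n → RelayNetwork.Seq n → ℝ,
        (∀ n, Measurable (Function.uncurry (D n))) ∧
        ∃ μ' : ℕ → ℝ → ℝ,
          Tendsto (Function.uncurry μ') (atTop ×ˢ 𝓝[>] (0 : ℝ)) (𝓝 0) ∧
          ∀ η : ℝ, 0 < η → ∃ thr : ℕ → ℝ → ℝ,
            (∀ n' δ, 0 < δ → 0 < thr n' δ ∧ thr n' δ < η) ∧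
            ∃ δ₀ > (0 : ℝ), ∃ ε₀ > (0 : ℝ),
              ∀ δ : ℝ, 0 < δ → δ < δ₀ → ∀ ε : ℝ, 0 < ε → ε < ε₀ →
              ∃ N : ℕ, ∀ n' ≥ N,
              ∀ K : ∀ n : ℕ, Kernel (RelayNetwork.Seq n) (RelayNetwork.Seq n),
                (∀ n, IsMarkovKernel (K n)) →
                (0 < liminf (fun n => RelayNetwork.networkLaw h₁ (K n)
                      {ω | δ < RelayNetwork.R Q h₁ n' ω}) atTop →
                  ∃ L : ℝ, 1 - ε ≤ L ∧
                    Tendsto (fun n =>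
                      (cond (RelayNetwork.networkLaw h₁ (K n))
                        {ω | δ < RelayNetwork.R Q h₁ n' ω}).real
                        {ω | thr n' δ < D n (RelayNetwork.seqX h₃ ω) (RelayNetwork.seqY h₂ ω)})
                      atTop (𝓝 L)) ∧
                (0 < liminf (fun n => RelayNetwork.networkLaw h₁ (K n)
                      {ω | RelayNetwork.R Q h₁ n' ω < δ}) atTop →
                  ∃ L : ℝ, L ≤ ε ∧
                    Tendsto (fun n =>
                      (cond (RelayNetwork.networkLaw h₁ (K n))
                        {ω | RelayNetwork.R Q h₁ n' ω ≤ δ}).real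
                        {ω | μ' n' δ < D n (RelayNetwork.seqX h₃ ω) (RelayNetwork.seqY h₂ ω)})
                      atTop (𝓝 L)) := by
  constructor
  · intro hNM
    have hne : ¬(h₁ = 0 ∨ h₂ = 0 ∨ h₃ = 0) := fun h =>
      hNM (RelayNetwork.manipulable_of_eq_zero h)
    push Not at hne
    obtain ⟨hh₁, hh₂, hh₃⟩ := hne
    exact RelayNetwork.detectable_of_ne_zero Q hh₁ hh₂ hh₃
  · rintro ⟨D, hD, μ', hμ', hdet⟩
    by_contra hM
    have hzero : h₁ = 0 ∨ h₂ = 0 ∨ h₃ = 0 := by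
      by_contra hne
      push Not at hne
      exact hM (RelayNetwork.nonManipulable_of_ne_zero hne.1 hne.2.1 hne.2.2)
    exact RelayNetwork.not_detects_of_eq_zero Q hzero hD hμ' hdet
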